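/- **Setting.** Let $\mathbb T^3=\mathbb R^3/2\pi\mathbb Z^3$. A *convex neighbourhood* in $\mathbb T^3$ is either $\mathbb T^3$ itself or the image of an open convex subset of $\mathbb R^3$ contained in a closed cube of side $2\pi$. *Pipe flows.* Let $\mathcal K\subset\mathbb S^2\cap\mathbb Q^3$ be a finite set of directions. For each $\xi\in\mathcal K$ fix a rational orthonormal frame $(e_1,e_2,\xi)$, a positive integer $n_\xi$ with $n_\xi e_1,n_\xi e_2,n_\xi\xi\in\mathbb Z^3$, and a profile $\varrho=\Delta^d\vartheta$, where $d\in\mathbb N$ and $\vartheta\in C^\infty(\mathbb R^2)$ is radially symmetric and supported in the closed ball of radius $\frac14$ about $0$. For $\lambda r\in\mathbb N_{>0}$, $0<r\le 1$ and a shift $s\in\mathbb R^2$, the intermittent pipe flow is $$\mathbb W_{\xi,\lambda,r}(x)=\xi\sum_{j\in\mathbb Z^2}\frac1{2\pi r}\,\varrho\!\left(\frac{n_\xi\lambda r\,(x\cdot e_1,x\cdot e_2)-s-2\pi j}{2\pi r}\right),$$ a $\mathbb T^3/(\lambda r)$-periodic field concentrated around lines parallel to $\xi$. **Proposition.** Let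 $\epsilon_0>0$, $\mathcal C_\Phi\in\mathbb R$ and $m_1,m_2\in\mathbb N$. There is a constant $C>0$, depending only on $\epsilon_0$, on $\mathcal K$ (with the chosen frames, integers and profiles), on $\mathcal C_\Phi$ and on $m_1,m_2$, such that the following holds. Let $\xi_1,\xi_2\in\mathcal K$ and $\ell>0$ satisfy $|\langle\xi_1,\xi_2\rangle|\le 1-\epsilon_0$ and $\ell^{1/3}\le\frac{\epsilon_0}2$, and put $\tau=\ell^3$. Let $\lambda_{q+1},r_1,r_2$ be real and $N_{\rm dec}\in\mathbb N$, with $\lambda_{q+1}r_2$ a positive integer and $$0\le r_1\le r_2\le1,\qquad r_2>0,\qquad \frac{r_1}{r_2}\le\frac23,\qquad(\lambda_{q+1}r_1)^{N_{\rm dec}+4}\le(\lambda_{q+1}r_2)^{N_{\rm dec}}.$$ Let $v$ be a smooth divergence-free time-dependent velocity field on $\mathbb T^3$, let $t_1,t_2\in\mathbb R$, and for $i=1,2$ let $\Phi_i$ be the inverse of the flow of $v$ started from the identity at time $t_i$, that is, the smooth solution of $\partial_t\Phi_i+v\cdot\nabla\Phi_i=0$, $\Phi_i|_{t=t_i}=x$.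 Let $\Omega^1,\Omega^2$ be convex neighbourhoods in $\mathbb T^3$, put $\Omega^i(t)=\{x:\Phi_i(x,t)\in\Omega^i\}$, and assume for $i=1,2$, all $t\in[t_i-\tau,t_i+\tau]$ and all $x\in\Omega^i(t)$ that $$|\nabla v(x,t)|\lesssim\ell^{-3/2},\qquad|\nabla\Phi_i-\mathrm{Id}|\le\ell,\qquad|\nabla^n\Phi_i|\le\mathcal C_\Phi(\lambda_{q+1}r_1)^{n-1}\quad(1\le n\le\max(m_1,m_2)),$$ where $C$ does not depend on the implicit constant in the first bound. Let $I=[t_1-\tau,t_1+\tau]\cap[t_2-\tau,t_2+\tau]$ and $\Omega(t)=\Omega^1(t)\cap\Omega^2(t)$, and assume $\Omega(t_0)\ne\emptyset$ for some $t_0\in I$. For $t\in I$ let $N(t)\supseteq\Omega(t)$ be the set of points at distance less than $(\lambda_{q+1}r_2)^{-1}$ from $\Omega(t)$, let $f(t,\cdot)\in C^{N_{\rm dec}+4}(N(t))$, and assume for some $\mathcal C_f\ge0$ that $$\|D^nf(t,\cdot)\|_{L^1(N(t))}\le\mathcal C_f(\lambda_{q+1}r_1)^n,\qquad 0\le n\le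 N_{\rm dec}+4,\ t\in I.$$ Let $\mathbb W^i=\mathbb W_{\xi_i,\lambda_{q+1},r_2}\circ\Phi_i$, with arbitrary shifts. Then for all $t\in I$, $$\big\|f(t,\cdot)\,\nabla^{m_1}\mathbb W^1(t,\cdot)\otimes\nabla^{m_2}\mathbb W^2(t,\cdot)\big\|_{L^1(\Omega(t))}\le C\,r_2\,\mathcal C_f\,\lambda_{q+1}^{m_1+m_2}.$$ -/

import Mathlib

open scoped ContDiff

noncomputable section

/-- Euclidean three-space, the universal cover of the torus `𝕋³ = ℝ³ / 2πℤ³`.  Functions on the torus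
are `2πℤ³`-periodic functions on `Space`, subsets of the torus are `2πℤ³`-periodic subsets. -/
abbrev Space : Type := EuclideanSpace ℝ (Fin 3)

/-- The Euclidean plane, in which the cross-sections of pipes live. -/
abbrev Plane : Type := EuclideanSpace ℝ (Fin 2)

/-- The vector `2πk` of the period lattice. -/
def latticeVec (k : Fin 3 → ℤ) : Space :=
  WithLp.toLp 2 (fun i => 2 * Real.pi * (k i : ℝ))

/-- The fundamental cell `[0, 2π)³` of the torus. -/
def torusCell : Set Space :=
  {x | ∀ i, 0 ≤ x i ∧ x i < 2 * Real.pi}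

/-- The `L¹` norm over the part `S` of the torus of a function whose pointwise norm is `g`. -/
def torusL1Norm (S : Set Space) (g : Space → ℝ) : ENNReal :=
  ∫⁻ x in S ∩ torusCell, ENNReal.ofReal (g x)

/-- A convex neighbourhood in the torus, given by its full preimage `Ω` in `Space`: `Ω` is covered by
the lattice translates of an open convex set `C`, which is either all of space (so that the
neighbourhood is the whole torus) or is contained in a closed period cube. -/
def IsConvexNeighborhood (Ω : Set Space) : Prop :=
  ∃ C : Set Space, IsOpen C ∧ Convex ℝ C ∧
    (C = Set.univ ∨ ∃ a : Space, ∀ x ∈ C, ∀ i, a i ≤ x i ∧ x i ≤ a i + 2 * Real.pi) ∧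
    Ω = {x | ∃ k : Fin 3 → ℤ, x + latticeVec k ∈ C}

/-! ### Intermittent pipe flows -/

/-- A rational orthonormal frame `(e₁, e₂, ξ)` with a common denominator `n`. -/
structure RationalFrame (ξ : Space) where
  e₁ : Space
  e₂ : Space
  orthonormal : Orthonormal ℝ ![e₁, e₂, ξ]
  n : ℕ
  n_pos : 0 < n
  integral_e₁ : ∀ i, ∃ z : ℤ, (n : ℝ) * e₁ i = z
  integral_e₂ : ∀ i, ∃ z : ℤ, (n : ℝ) * e₂ i = z
  integral_axis : ∀ i, ∃ z : ℤ, (n : ℝ) * ξ i = z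

/-- A pipe profile: a smooth, radially symmetric potential `ϑ` on the plane, supported in a
ball of radius `1/4`, and a number `d` of Laplacians. -/
structure PipeProfile where
  potential : Plane → ℝ
  d : ℕ
  smooth : ContDiff ℝ ∞ potential
  radial : ∀ y z : Plane, ‖y‖ = ‖z‖ → potential y = potential z
  support_subset : tsupport potential ⊆ Metric.closedBall 0 (1 / 4)

/-- The unit-scale density `ϱ = Δᵈ ϑ`. -/
def PipeProfile.density (P : PipeProfile) : Plane → ℝ :=
  (Laplacian.laplacian : (Plane → ℝ) → Plane → ℝ)^[P.d] P.potential

/-- The density `ϱ_{ξ,λ,r}` on the torus.  The profile is concentrated to scale `2πr` with amplitude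
`(2πr)⁻¹`, made `2πℤ²`-periodic, evaluated at `nλr (x·e₁, x·e₂)`, and shifted by `s`.
It is constant in the direction `ξ` and `2πℤ³/(λr)`-periodic when `λr` is a positive integer. -/
def pipeDensity {ξ : Space} (F : RationalFrame ξ) (P : PipeProfile) (lam r : ℝ) (s : Plane)
    (x : Space) : ℝ :=
  ∑' j : Fin 2 → ℤ, (2 * Real.pi * r)⁻¹ *
    P.density ((2 * Real.pi * r)⁻¹ •
      (WithLp.toLp 2 ![(F.n : ℝ) * lam * r * inner ℝ x F.e₁ - s 0 - 2 * Real.pi * (j 0 : ℝ),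
        (F.n : ℝ) * lam * r * inner ℝ x F.e₂ - s 1 - 2 * Real.pi * (j 1 : ℝ)] : Plane))

/-- The straight intermittent pipe flow `𝕎_{ξ,λ,r} = ϱ_{ξ,λ,r} ξ`. -/
def pipeFlow {ξ : Space} (F : RationalFrame ξ) (P : PipeProfile) (lam r : ℝ) (s : Plane)
    (x : Space) : Space :=
  pipeDensity F P lam r s x • ξ

/-! ### Velocity fields and their flows -/

/-- A smooth, divergence-free, time-dependent velocity field on the torus. -/
structure IsIncompressibleVelocity (v : ℝ → Space → Space) : Prop where
  smooth : ContDiff ℝ ∞ (fun p : ℝ × Space => v p.1 p.2)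
  periodic : ∀ t x (k : Fin 3 → ℤ), v t (x + latticeVec k) = v t x
  div_free : ∀ t x, ∑ i : Fin 3, (fderiv ℝ (v t) x (EuclideanSpace.single i 1)) i = 0

/-- `X` is the flow of `v` which is the identity at time `t₀`. -/
structure IsFlow (v : ℝ → Space → Space) (t₀ : ℝ) (X : ℝ → Space → Space) : Prop where
  ode : ∀ t x, HasDerivAt (fun s => X s x) (v t (X t x)) t
  init : ∀ x, X t₀ x = x

/-- `Φ` is the inverse of the flow `X` of `v` started at `t₀`: the smooth solution of
`∂ₜΦ + v·∇Φ = 0`, `Φ(t₀, x) = x`, as a map of the torus. -/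
structure IsInverseFlow (v : ℝ → Space → Space) (t₀ : ℝ) (X Φ : ℝ → Space → Space) : Prop where
  smooth : ContDiff ℝ ∞ (fun p : ℝ × Space => Φ p.1 p.2)
  equivariant : ∀ t x (k : Fin 3 → ℤ), Φ t (x + latticeVec k) = Φ t x + latticeVec k
  transport : ∀ t x, deriv (fun s => Φ s x) t + fderiv ℝ (Φ t) x (v t x) = 0
  init : ∀ x, Φ t₀ x = x
  left_inv : ∀ t x, Φ t (X t x) = x
  right_inv : ∀ t x, X t (Φ t x) = x

/-- The moving domain `Ω(t) = {x : Φ(t, x) ∈ Ω}`. -/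
def movingDomain (Φ : ℝ → Space → Space) (Ω : Set Space) (t : ℝ) : Set Space :=
  {x | Φ t x ∈ Ω}

end

/-! The estimate at a fixed time is elementary once the scales are separated.

Composition with `Φ` costs a factor `lam` per derivative, so each `∇ᵐ(𝕎 ∘ Φ)` is bounded by a
multiple of `lam ^ m / r₂` and lives in the pulled-back pipes
(`exists_iteratedFDeriv_pipeFlow_bound`).  It remains to see that the intersection of the two
families of pipes has relative density `≲ r₂ ^ 3` as seen by `f`.

Over each convex piece of a neighbourhood, `Φ` is almost an isometry: its inverse has derivative
close to the identity there, and the mean value inequality applies (`norm_sub_sub_map_sub_le`; this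
is where the convexity of the neighbourhoods enters).  Two points in the intersection of one deformed
pipe of each family therefore differ by a vector which is close to both axes, up to an error
`≲ lam⁻¹` and a small multiple of its own length; the axes being transversal, this vector has length
`≲ lam⁻¹`.  A set whose diameter is at most the spacing `(lam * r₂)⁻¹` meets boundedly many pieces
and pipes, so the pipes intersect in it in a set of volume `≲ lam⁻³`
(`exists_volume_inter_pipeRegion_bound`).

On a cube of side comparable to the spacing, the embedding of `W^{3,1}` into `L^∞` bounds `f` by
`(lam * r₂) ^ 3` times its `L¹` norms (`enorm_le_sum_lintegral_cube`); the derivatives of `f` are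
harmless since `r₁ ≤ r₂`.  Summation over the cubes which tile the torus
(`torusL1Norm_le_of_concentrated`) gives the factor
`lam⁻³ * (lam * r₂) ^ 3 * r₂⁻² = r₂`. -/

/-! ### Pipes and their deformations -/

theorem contDiff_iterate_laplacian {f : Plane → ℝ} (hf : ContDiff ℝ ∞ f) (n : ℕ) :
    ContDiff ℝ ∞ ((Laplacian.laplacian : (Plane → ℝ) → Plane → ℝ)^[n] f) := by
  induction n with
  | zero => simpa using hf
  | succ n ih =>
    rw [Function.iterate_succ_apply',
      InnerProductSpace.laplacian_eq_iteratedFDeriv_stdOrthonormalBasis]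
    refine ContDiff.sum fun i _ => ?_
    have h : ContDiff ℝ ∞ (iteratedFDeriv ℝ 2
        ((Laplacian.laplacian : (Plane → ℝ) → Plane → ℝ)^[n] f)) :=
      ih.iteratedFDeriv_right (by norm_cast)
    exact (ContinuousMultilinearMap.apply ℝ (fun _ : Fin 2 => Plane) ℝ _).contDiff.comp h

theorem tsupport_iterate_laplacian_subset (f : Plane → ℝ) (n : ℕ) :
    tsupport ((Laplacian.laplacian : (Plane → ℝ) → Plane → ℝ)^[n] f) ⊆ tsupport f := by
  induction n with
  | zero => simp
  | succ n ih =>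
    rw [Function.iterate_succ_apply',
      InnerProductSpace.laplacian_eq_iteratedFDeriv_stdOrthonormalBasis]
    refine (closure_minimal ?_ (isClosed_tsupport _)).trans ih
    intro y hy
    by_contra hy'
    have h0 := Function.notMem_support.1
      fun h => hy' (support_iteratedFDeriv_subset (𝕜 := ℝ) 2 h)
    exact hy (by simp [h0])

namespace PipeProfile

theorem density_contDiff (P : PipeProfile) : ContDiff ℝ ∞ P.density :=
  contDiff_iterate_laplacian P.smooth P.d

theorem tsupport_density_subset (P : PipeProfile) :
    tsupport P.density ⊆ Metric.closedBall 0 (1 / 4) :=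
  (tsupport_iterate_laplacian_subset _ _).trans P.support_subset

theorem exists_iteratedFDeriv_density_bound (P : PipeProfile) (m : ℕ) :
    ∃ M : ℝ, 0 < M ∧ ∀ i ≤ m, ∀ y, ‖iteratedFDeriv ℝ i P.density y‖ ≤ M := by
  have hc : HasCompactSupport P.density :=
    (isCompact_closedBall (0 : Plane) (1 / 4)).of_isClosed_subset (isClosed_tsupport _)
      P.tsupport_density_subset
  have h : ∀ i, ∃ M, ∀ y, ‖iteratedFDeriv ℝ i P.density y‖ ≤ M := fun i =>
    (hc.iteratedFDeriv i).exists_bound_of_continuous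
      (P.density_contDiff.continuous_iteratedFDeriv (by exact_mod_cast le_top))
  choose M hM using h
  refine ⟨1 + ∑ i ∈ Finset.range (m + 1), |M i|, by positivity, fun i hi y => ?_⟩
  have := Finset.single_le_sum (f := fun i => |M i|) (fun _ _ => abs_nonneg _)
    (Finset.mem_range.2 (Nat.lt_succ_of_le hi))
  linarith [hM i y, le_abs_self (M i)]

end PipeProfile

/-- The rescaled position of `x` in the cross-section of the pipe with index `j`: the argument at
which the `j`-th term of `pipeDensity` evaluates the profile. -/
noncomputable def pipeCoord {ξ : Space} (F : RationalFrame ξ) (lam r : ℝ) (s : Plane) (x : Space)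
    (j : Fin 2 → ℤ) : Plane :=
  (2 * Real.pi * r)⁻¹ •
    (WithLp.toLp 2 ![(F.n : ℝ) * lam * r * inner ℝ x F.e₁ - s 0 - 2 * Real.pi * (j 0 : ℝ),
      (F.n : ℝ) * lam * r * inner ℝ x F.e₂ - s 1 - 2 * Real.pi * (j 1 : ℝ)] : Plane)

/-- The orthogonal projection along the axis, in the coordinates of the frame. -/
noncomputable def RationalFrame.proj {ξ : Space} (F : RationalFrame ξ) : Space →L[ℝ] Plane :=
  (innerSL ℝ F.e₁).smulRight (EuclideanSpace.single 0 1) +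
    (innerSL ℝ F.e₂).smulRight (EuclideanSpace.single 1 1)

namespace RationalFrame

variable {ξ : Space} (F : RationalFrame ξ)

theorem norm_e₁ : ‖F.e₁‖ = 1 := F.orthonormal.1 0

theorem norm_e₂ : ‖F.e₂‖ = 1 := F.orthonormal.1 1

theorem norm_axis {ξ : Space} (F : RationalFrame ξ) : ‖ξ‖ = 1 := F.orthonormal.1 2

theorem norm_proj_le : ‖F.proj‖ ≤ 2 := by
  refine (norm_add_le _ _).trans ?_
  simp [ContinuousLinearMap.norm_smulRight_apply, F.norm_e₁, F.norm_e₂]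
  norm_num

end RationalFrame

theorem pipeCoord_eq {ξ : Space} (F : RationalFrame ξ) (lam : ℝ) {r : ℝ} (hr : 0 < r) (s : Plane)
    (x : Space) (j : Fin 2 → ℤ) :
    pipeCoord F lam r s x j = ((F.n * lam / (2 * Real.pi)) • F.proj) x +
      pipeCoord F lam r s 0 j := by
  have := Real.pi_pos
  ext i
  fin_cases i <;>
    simp [pipeCoord, RationalFrame.proj, real_inner_comm] <;> field_simp <;> ring

/-- Near every point at most one term of the periodization is nonzero, since the profile is
supported in a ball much smaller than a period. -/
theorem exists_pipeDensity_eventuallyEq {ξ : Space} (F : RationalFrame ξ) (P : PipeProfile)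
    (lam : ℝ) {r : ℝ} (hr : 0 < r) (hr1 : r ≤ 1) (s : Plane) (x : Space) :
    ∃ j : Fin 2 → ℤ, pipeDensity F P lam r s =ᶠ[nhds x]
      fun y => (2 * Real.pi * r)⁻¹ * P.density (pipeCoord F lam r s y j) := by
  have hpi := Real.pi_pos
  set z : Space → Fin 2 → ℝ := fun y =>
    ![(F.n : ℝ) * lam * r * inner ℝ y F.e₁ - s 0, (F.n : ℝ) * lam * r * inner ℝ y F.e₂ - s 1]
    with hz
  have hco : ∀ y j i, pipeCoord F lam r s y j i =
      (2 * Real.pi * r)⁻¹ * (z y i - 2 * Real.pi * j i) := by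
    intro y j i
    fin_cases i <;> simp [pipeCoord, hz]
  have hzc : ∀ i, Continuous fun y => z y i := by
    intro i
    fin_cases i <;> simp only [hz] <;> simp <;> fun_prop
  -- the index of the pipe whose axis is nearest
  refine ⟨fun i => round (z x i / (2 * Real.pi)), ?_⟩
  have hev : ∀ᶠ y in nhds x, ∀ i, |z y i - z x i| < Real.pi / 4 := by
    refine Filter.eventually_all.2 fun i => ?_
    have := (Metric.continuous_iff.1 (hzc i)) x (Real.pi / 4) (by positivity)
    obtain ⟨δ, hδ, h⟩ := this
    exact Metric.eventually_nhds_iff.2 ⟨δ, hδ, fun y hy => by simpa [Real.dist_eq] using h y hy⟩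
  filter_upwards [hev] with y hy
  refine tsum_eq_single (fun i => round (z x i / (2 * Real.pi))) fun j hj => ?_
  refine mul_eq_zero_of_right _ ?_
  change P.density (pipeCoord F lam r s y j) = 0
  by_contra hne
  have hmem : pipeCoord F lam r s y j ∈ Metric.closedBall (0 : Plane) (1 / 4) :=
    P.tsupport_density_subset (subset_tsupport _ hne)
  rw [mem_closedBall_zero_iff] at hmem
  refine hj (funext fun i => ?_)
  have h1 : |pipeCoord F lam r s y j i| ≤ 1 / 4 :=
    (PiLp.norm_apply_le (pipeCoord F lam r s y j) i).trans hmem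
  have h2 : |z y i - 2 * Real.pi * j i| ≤ Real.pi / 2 * r := by
    rw [hco, abs_mul, abs_of_pos (by positivity), inv_mul_le_iff₀ (by positivity)] at h1
    linarith
  have h3 : |z x i - 2 * Real.pi * j i| < 3 / 4 * Real.pi := by
    have := hy i
    rw [abs_lt] at this ⊢
    rw [abs_le] at h2
    constructor <;> nlinarith
  have h4 : |z x i / (2 * Real.pi) - j i| < 1 / 2 := by
    have : z x i / (2 * Real.pi) - j i = (z x i - 2 * Real.pi * j i) / (2 * Real.pi) := by
      field_simp
    rw [this, abs_div, abs_of_pos (by positivity : 0 < 2 * Real.pi), div_lt_iff₀ (by positivity)]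
    linarith
  have h5 := abs_sub_round (z x i / (2 * Real.pi))
  have h6 : |(j i : ℝ) - round (z x i / (2 * Real.pi))| < 1 := by
    rw [abs_lt] at h4 ⊢
    rw [abs_le] at h5
    constructor <;> linarith
  have h7 : |j i - round (z x i / (2 * Real.pi))| < 1 := by exact_mod_cast h6
  have := Int.abs_lt_one_iff.1 h7
  change j i = round (z x i / (2 * Real.pi))
  omega

/-- The derivatives of a pipe flow composed with a deformation `Φ` cost a factor `lam` each, and
they vanish at the points which `Φ` does not map into one of the pipes. -/
theorem exists_iteratedFDeriv_pipeFlow_bound {ξ : Space} (F : RationalFrame ξ) (P : PipeProfile)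
    (CΦ : ℝ) (m : ℕ) :
    ∃ K : ℝ, 0 < K ∧ ∀ (lam r₁ r : ℝ), 0 < lam → 0 ≤ r₁ → r₁ ≤ 1 → 0 < r → r ≤ 1 →
      ∀ (s : Plane) (Φ : Space → Space), ContDiff ℝ ∞ Φ → ∀ x : Space,
        (∀ n : ℕ, 1 ≤ n → n ≤ m → ‖iteratedFDeriv ℝ n Φ x‖ ≤ CΦ * (lam * r₁) ^ (n - 1)) →
        ‖iteratedFDeriv ℝ m (fun y => pipeFlow F P lam r s (Φ y)) x‖ ≤ K * (lam ^ m * r⁻¹) ∧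
        ((∀ j, 1 / 4 < ‖pipeCoord F lam r s (Φ x) j‖) →
          iteratedFDeriv ℝ m (fun y => pipeFlow F P lam r s (Φ y)) x = 0) := by
  obtain ⟨M, hM, hMb⟩ := P.exists_iteratedFDeriv_density_bound m
  have hpi3 := Real.pi_gt_three
  set A : ℝ := max 1 (F.n * |CΦ|)
  have hA1 : 1 ≤ A := le_max_left _ _
  refine ⟨m.factorial * M * A ^ m, by positivity, ?_⟩
  intro lam r₁ r hlam hr₁ hr₁1 hr hr1 s Φ hΦ x hx
  obtain ⟨j, hj⟩ := exists_pipeDensity_eventuallyEq F P lam hr hr1 s (Φ x)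
  set L : ℝ →L[ℝ] Space := (2 * Real.pi * r)⁻¹ • ContinuousLinearMap.toSpanSingleton ℝ ξ with hL
  set c : Plane := pipeCoord F lam r s 0 j with hc
  set B : Space →L[ℝ] Plane := (F.n * lam / (2 * Real.pi)) • F.proj with hB
  set G : Plane → Space := fun z => (L ∘ P.density) (z + c) with hG
  have hGs : ContDiff ℝ ∞ G :=
    (L.contDiff.comp P.density_contDiff).comp (contDiff_id.add contDiff_const)
  have heq : (fun y => pipeFlow F P lam r s (Φ y)) =ᶠ[nhds x] G ∘ (B ∘ Φ) := by
    filter_upwards [hΦ.continuous.continuousAt.eventually hj] with y hy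
    simp only [pipeFlow, hy, pipeCoord_eq F lam hr s (Φ y) j, hG, hL, Function.comp]
    simp [smul_smul, hB, hc]
  have hGi : ∀ i z, iteratedFDeriv ℝ i G z =
      L.compContinuousMultilinearMap (iteratedFDeriv ℝ i P.density (z + c)) := by
    intro i z
    rw [hG, iteratedFDeriv_comp_add_right,
      L.iteratedFDeriv_comp_left P.density_contDiff.contDiffAt (by exact_mod_cast le_top)]
  rw [(heq.iteratedFDeriv ℝ m).eq_of_nhds]
  constructor
  · have hLn : ‖L‖ ≤ r⁻¹ := by
      rw [hL, norm_smul, ContinuousLinearMap.norm_toSpanSingleton, F.norm_axis, mul_one,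
        Real.norm_of_nonneg (by positivity)]
      apply inv_anti₀ hr
      nlinarith
    have hBn : ‖B‖ ≤ F.n * lam := by
      have h2 := F.norm_proj_le
      rw [hB, norm_smul, Real.norm_of_nonneg (by positivity)]
      calc F.n * lam / (2 * Real.pi) * ‖F.proj‖ ≤ F.n * lam / 2 * 2 := by gcongr; linarith
        _ = _ := by ring
    have h := norm_iteratedFDeriv_comp_le (n := m) (N := ∞) hGs (B.contDiff.comp hΦ)
      (by exact_mod_cast le_top) x (C := r⁻¹ * M) (D := A * lam) ?_ ?_
    · refine h.trans (le_of_eq ?_)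
      rw [mul_pow]; ring
    · intro i hi
      rw [hGi]
      refine (ContinuousLinearMap.norm_compContinuousMultilinearMap_le _ _).trans ?_
      gcongr
      exact hMb i hi _
    · intro i h1 hi
      refine (B.norm_iteratedFDeriv_comp_left hΦ.contDiffAt (N := ∞)
        (by exact_mod_cast le_top)).trans ?_
      obtain ⟨k, rfl⟩ := Nat.exists_eq_add_of_le' h1
      calc ‖B‖ * ‖iteratedFDeriv ℝ (k + 1) Φ x‖
          ≤ (F.n * lam) * (|CΦ| * lam ^ k) := by
            gcongr
            refine (hx _ h1 hi).trans ?_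
            rw [Nat.add_sub_cancel]
            have : (lam * r₁) ^ k ≤ lam ^ k := by
              gcongr; nlinarith
            gcongr
            exact le_abs_self _
        _ = (F.n * |CΦ|) * lam ^ (k + 1) := by ring
        _ ≤ A ^ (k + 1) * lam ^ (k + 1) := by
            gcongr
            exact (le_max_right _ _).trans (le_self_pow₀ hA1 (by omega))
        _ = _ := by rw [mul_pow]
  · intro hfar
    refine Function.notMem_support.1 fun h => ?_
    have h1 := support_iteratedFDeriv_subset (𝕜 := ℝ) m h
    have hev : G ∘ (B ∘ Φ) =ᶠ[nhds x] 0 := by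
      have h2 : ∀ᶠ y in nhds x, 1 / 4 < ‖B (Φ y) + c‖ := by
        have hcont : Continuous fun y => ‖B (Φ y) + c‖ :=
          ((B.continuous.comp hΦ.continuous).add continuous_const).norm
        refine hcont.continuousAt.eventually (lt_mem_nhds ?_)
        simpa [pipeCoord_eq F lam hr s (Φ x) j, hB, hc] using hfar j
      filter_upwards [h2] with y hy
      have : P.density (B (Φ y) + c) = 0 := by
        by_contra hne
        have := P.tsupport_density_subset (subset_tsupport _ hne)
        rw [mem_closedBall_zero_iff] at this
        linarith
      simp [hG, this]
    exact notMem_tsupport_iff_eventuallyEq.2 hev h1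

/-! ### Intersections of transversal deformed pipes -/

/-- A map with a left inverse whose derivative is close to the identity over a convex set `C` of the
image is almost an isometry there: the left inverse is differentiable on `C`, with derivative close
to the identity, and the mean value inequality applies to it. -/
theorem norm_sub_sub_map_sub_le {E : Type*} [NormedAddCommGroup E] [NormedSpace ℝ E]
    [CompleteSpace E] {Φ X : E → E} {C : Set E} {ell : ℝ} (hell : ell ≤ 1 / 8)
    (hΦ : ContDiff ℝ ∞ Φ) (hXΦ : ∀ x, X (Φ x) = x) (hΦX : ∀ y, Φ (X y) = y) (hC : Convex ℝ C)
    (hb : ∀ x, Φ x ∈ C → ‖fderiv ℝ Φ x - ContinuousLinearMap.id ℝ E‖ ≤ ell)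
    {x y : E} (hx : Φ x ∈ C) (hy : Φ y ∈ C) :
    ‖(x - y) - (Φ x - Φ y)‖ ≤ 8 / 7 * ell * ‖Φ x - Φ y‖ := by
  have key : ∀ z ∈ C, ∃ S : E →L[ℝ] E, HasFDerivAt X S z ∧
      ‖S - ContinuousLinearMap.id ℝ E‖ ≤ 8 / 7 * ell := by
    intro z hz
    have hz' : Φ (X z) ∈ C := by rwa [hΦX]
    -- the derivative of `Φ` is inverted by the Neumann series
    have hT := hb _ hz'
    set T := fderiv ℝ Φ (X z)
    have hell0 : 0 ≤ ell := (norm_nonneg _).trans hT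
    have hlt : ‖(1 : E →L[ℝ] E) - T‖ < 1 := by
      rw [norm_sub_rev]; exact hT.trans_lt (by linarith)
    let u : (E →L[ℝ] E)ˣ := Units.oneSub (1 - T) hlt
    have hu : (u : E →L[ℝ] E) = T := by simp [u]
    let e : E ≃L[ℝ] E := ContinuousLinearEquiv.ofUnit u
    have he : (e : E →L[ℝ] E) = T := hu
    have hd : HasStrictFDerivAt Φ (e : E →L[ℝ] E) (X z) := by
      rw [he]
      exact hΦ.contDiffAt.hasStrictFDerivAt (by simp)
    have hXd := hd.to_local_left_inverse (Filter.Eventually.of_forall hXΦ)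
    rw [hΦX] at hXd
    refine ⟨_, hXd.hasFDerivAt, ?_⟩
    set S : E →L[ℝ] E := (e.symm : E →L[ℝ] E) with hS
    have hST : S * T = 1 := by
      rw [← he]; ext v; simp [hS]
    have h1 : S - 1 = S * (1 - T) := by rw [mul_sub, hST, mul_one]
    have h2 : ‖S - 1‖ ≤ ‖S‖ * ell := by
      rw [h1]
      refine (norm_mul_le _ _).trans ?_
      gcongr
      rw [norm_sub_rev]; exact hT
    have h3 : ‖S‖ ≤ 1 + ‖S - 1‖ := by
      have : S = 1 + (S - 1) := by abel
      calc ‖S‖ = ‖1 + (S - 1)‖ := by rw [← this]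
        _ ≤ ‖(1 : E →L[ℝ] E)‖ + ‖S - 1‖ := norm_add_le _ _
        _ ≤ _ := by gcongr; exact ContinuousLinearMap.norm_id_le
    change ‖S - 1‖ ≤ _
    have h4 : ‖S‖ ≤ 8 / 7 := by nlinarith [norm_nonneg S]
    nlinarith
  have hmain := hC.norm_image_sub_le_of_norm_hasFDerivWithin_le' (f := X)
    (f' := fderiv ℝ X) (φ := ContinuousLinearMap.id ℝ E) (C := 8 / 7 * ell)
    (fun z hz => by
      obtain ⟨S, hS, -⟩ := key z hz
      exact hS.differentiableAt.hasFDerivAt.hasFDerivWithinAt)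
    (fun z hz => by
      obtain ⟨S, hS, hS'⟩ := key z hz
      rwa [hS.fderiv]) hy hx
  simpa [hXΦ] using hmain

/-- If the indices of the sets `S j` which meet `A` differ by at most `N` in each coordinate, then
only `(2N+1)^d` of these sets contribute to `A`. -/
theorem measure_inter_iUnion_le_of_index_close {α : Type*} [MeasurableSpace α]
    (μ : MeasureTheory.Measure α) {d : ℕ} (A : Set α) (S : (Fin d → ℤ) → Set α) (N : ℕ)
    (b : ENNReal)
    (hclose : ∀ j j', ∀ x ∈ A ∩ S j, ∀ y ∈ A ∩ S j', ∀ i, |j i - j' i| ≤ N)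
    (hb : ∀ j, μ (A ∩ S j) ≤ b) :
    μ (A ∩ ⋃ j, S j) ≤ ((2 * N + 1) ^ d : ℕ) * b := by
  rcases (A ∩ ⋃ j, S j).eq_empty_or_nonempty with h | ⟨x, hxA, hx⟩
  · simp [h]
  obtain ⟨j₀, hj₀⟩ := Set.mem_iUnion.1 hx
  have hsub : A ∩ ⋃ j, S j ⊆
      ⋃ j ∈ Finset.Icc (fun i => j₀ i - (N : ℤ)) (fun i => j₀ i + (N : ℤ)), A ∩ S j := by
    rintro y ⟨hyA, hy⟩
    obtain ⟨j, hj⟩ := Set.mem_iUnion.1 hy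
    refine Set.mem_biUnion (x := j) ?_ ⟨hyA, hj⟩
    have h := fun i => abs_le.1 (hclose j j₀ y ⟨hyA, hj⟩ x ⟨hxA, hj₀⟩ i)
    simp only [Finset.coe_Icc, Set.mem_Icc, Pi.le_def]
    exact ⟨fun i => by linarith [(h i).1], fun i => by linarith [(h i).2]⟩
  refine (MeasureTheory.measure_mono hsub).trans
    ((MeasureTheory.measure_biUnion_finset_le _ _).trans ?_)
  refine (Finset.sum_le_sum fun j _ => hb j).trans (le_of_eq ?_)
  have hcard : ∀ i, (j₀ i + (N : ℤ) + 1 - (j₀ i - N)).toNat = 2 * N + 1 := fun i => by omega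
  simp [Pi.card_Icc, Int.card_Icc, hcard]

theorem measure_le_of_norm_sub_le {T : Set Space} {D : ℝ} (hD : 0 ≤ D)
    (h : ∀ x ∈ T, ∀ y ∈ T, ‖x - y‖ ≤ D) :
    MeasureTheory.volume T ≤
      ENNReal.ofReal ((MeasureTheory.volume (Metric.ball (0 : Space) 1)).toReal * D ^ 3) := by
  rcases T.eq_empty_or_nonempty with rfl | ⟨x, hx⟩
  · simp
  have hsub : T ⊆ Metric.closedBall x D := fun y hy => by
    rw [mem_closedBall_iff_norm]; exact h y hy x hx
  refine (MeasureTheory.measure_mono hsub).trans (le_of_eq ?_)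
  rw [MeasureTheory.Measure.addHaar_closedBall _ _ hD, ENNReal.ofReal_mul ENNReal.toReal_nonneg,
    ENNReal.ofReal_toReal MeasureTheory.measure_ball_lt_top.ne, mul_comm]
  simp

theorem RationalFrame.norm_sub_inner_smul_le {ξ : Space} (F : RationalFrame ξ) (a : Space) :
    ‖a - inner ℝ ξ a • ξ‖ ≤ |inner ℝ a F.e₁| + |inner ℝ a F.e₂| := by
  obtain ⟨b, hb⟩ := Orthonormal.exists_orthonormalBasis_extension_of_card_eq (𝕜 := ℝ)
    (E := Space) (ι := Fin 3) (by simp) (v := ![F.e₁, F.e₂, ξ]) (s := Set.univ)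
    (F.orthonormal.comp _ Subtype.val_injective)
  have h0 : b 0 = F.e₁ := hb 0 trivial
  have h1 : b 1 = F.e₂ := hb 1 trivial
  have h2 : b 2 = ξ := hb 2 trivial
  have hsum := b.sum_repr' a
  rw [Fin.sum_univ_three, h0, h1, h2] at hsum
  have : a - inner ℝ ξ a • ξ = inner ℝ F.e₁ a • F.e₁ + inner ℝ F.e₂ a • F.e₂ := by
    rw [sub_eq_iff_eq_add, hsum]
  rw [this]
  refine (norm_add_le _ _).trans (le_of_eq ?_)
  rw [norm_smul, norm_smul, F.norm_e₁, F.norm_e₂, mul_one, mul_one, real_inner_comm,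
    real_inner_comm F.e₂, Real.norm_eq_abs, Real.norm_eq_abs]

/-- A vector which is close to both of two transversal lines is short. -/
theorem norm_le_of_close_to_two_lines {E : Type*} [NormedAddCommGroup E] [InnerProductSpace ℝ E]
    {ξ₁ ξ₂ w : E} {α β ε R : ℝ} (h1 : ‖ξ₁‖ = 1) (h2 : ‖ξ₂‖ = 1) (hε : 0 < ε) (hε1 : ε ≤ 1)
    (hang : |inner ℝ ξ₁ ξ₂| ≤ 1 - ε) (hα : ‖w - α • ξ₁‖ ≤ R) (hβ : ‖w - β • ξ₂‖ ≤ R) :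
    ‖w‖ ≤ 3 / ε * R := by
  have hR : 0 ≤ R := (norm_nonneg _).trans hα
  have hdiff : ‖α • ξ₁ - β • ξ₂‖ ≤ 2 * R := by
    have : α • ξ₁ - β • ξ₂ = (w - β • ξ₂) - (w - α • ξ₁) := by abel
    rw [this]
    exact (norm_sub_le _ _).trans (by linarith)
  have hsq : ‖α • ξ₁ - β • ξ₂‖ ^ 2 = α ^ 2 - 2 * (α * β * inner ℝ ξ₁ ξ₂) + β ^ 2 := by
    rw [norm_sub_sq_real, norm_smul, norm_smul, h1, h2, inner_smul_left, inner_smul_right]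
    simp
    ring
  have hc : α * β * inner ℝ ξ₁ ξ₂ ≤ |α| * |β| * (1 - ε) := by
    refine (le_abs_self _).trans ?_
    rw [abs_mul, abs_mul]
    gcongr
  have hle : ‖α • ξ₁ - β • ξ₂‖ ^ 2 ≤ (2 * R) ^ 2 := by gcongr
  have hα2 : (ε * |α|) ^ 2 ≤ (2 * R) ^ 2 := by
    have ha := sq_abs α
    have hb := sq_abs β
    nlinarith [sq_nonneg (|α| - |β|), sq_nonneg |β|, sq_nonneg |α|,
      mul_nonneg (sub_nonneg.2 hε1) (sq_nonneg (|α| - |β|)),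
      mul_nonneg (mul_nonneg hε.le (sub_nonneg.2 hε1)) (sq_nonneg |α|),
      mul_nonneg hε.le (sq_nonneg |β|)]
  have hα3 : ε * |α| ≤ 2 * R := abs_le_of_sq_le_sq' hα2 (by positivity) |>.2
  have hw : ‖w‖ ≤ |α| + R := by
    have : w = α • ξ₁ + (w - α • ξ₁) := by abel
    calc ‖w‖ = ‖α • ξ₁ + (w - α • ξ₁)‖ := by rw [← this]
      _ ≤ ‖α • ξ₁‖ + ‖w - α • ξ₁‖ := norm_add_le _ _
      _ ≤ |α| + R := by rw [norm_smul, h1, mul_one, Real.norm_eq_abs]; gcongr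
  rw [div_mul_eq_mul_div, le_div_iff₀ hε]
  nlinarith

theorem latticeVec_zero : latticeVec 0 = 0 := by
  ext i; simp [latticeVec]

theorem norm_latticeVec_apply_le {k : Fin 3 → ℤ} (i : Fin 3) :
    2 * Real.pi * |(k i : ℝ)| ≤ ‖latticeVec k‖ := by
  have h := PiLp.norm_apply_le (latticeVec k) i
  simpa [latticeVec, abs_mul, abs_of_pos Real.pi_pos] using h

/-- The preimage of a convex neighbourhood under a torus diffeomorphism close to the identity is a
union of pieces, indexed by the period lattice, on each of which the diffeomorphism is almost an
isometry.  Only boundedly many pieces come near a given point. -/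
theorem IsConvexNeighborhood.exists_almost_isometric_pieces {Ω : Set Space}
    (hΩ : IsConvexNeighborhood Ω) {Φ X : Space → Space} {ell : ℝ} (hell0 : 0 ≤ ell)
    (hell : ell ≤ 1 / 8) (hΦ : ContDiff ℝ ∞ Φ) (hXΦ : ∀ x, X (Φ x) = x) (hΦX : ∀ y, Φ (X y) = y)
    (heq : ∀ x k, Φ (x + latticeVec k) = Φ x + latticeVec k)
    (hb : ∀ x, Φ x ∈ Ω → ‖fderiv ℝ Φ x - ContinuousLinearMap.id ℝ Space‖ ≤ ell) :
    ∃ S : (Fin 3 → ℤ) → Set Space, Φ ⁻¹' Ω = ⋃ k, S k ∧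
      (∀ k, ∀ x ∈ S k, ∀ y ∈ S k, ‖(x - y) - (Φ x - Φ y)‖ ≤ 4 / 3 * ell * ‖x - y‖) ∧
      (∀ k k', ∀ x ∈ S k, ∀ y ∈ S k', ‖x - y‖ ≤ 1 → ∀ i, |k i - k' i| ≤ (3 : ℕ)) := by
  obtain ⟨C, -, hCc, hC, rfl⟩ := hΩ
  have hpi := Real.pi_gt_three
  have hpi4 := Real.pi_lt_four
  have h0 : ∀ x y, Φ x ∈ C → Φ y ∈ C → ‖(x - y) - (Φ x - Φ y)‖ ≤ 8 / 7 * ell * ‖Φ x - Φ y‖ :=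
    fun x y hx hy => norm_sub_sub_map_sub_le hell hΦ hXΦ hΦX hCc
      (fun z hz => hb z ⟨0, by rwa [latticeVec_zero, add_zero]⟩) hx hy
  have hiso : ∀ x y, Φ x ∈ C → Φ y ∈ C →
      ‖(x - y) - (Φ x - Φ y)‖ ≤ 4 / 3 * ell * ‖x - y‖ := by
    intro x y hx hy
    have h := h0 x y hx hy
    have h1 : ‖Φ x - Φ y‖ ≤ ‖x - y‖ + ‖(x - y) - (Φ x - Φ y)‖ := by
      rw [norm_sub_rev (x - y)]
      have := norm_add_le (x - y) ((Φ x - Φ y) - (x - y))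
      rwa [add_sub_cancel] at this
    have h2 : ‖Φ x - Φ y‖ ≤ 7 / 6 * ‖x - y‖ := by
      nlinarith [norm_nonneg (Φ x - Φ y)]
    nlinarith
  rcases hC with rfl | ⟨a, ha⟩
  -- the whole torus is a single piece, which is put at the index `0`
  · refine ⟨fun k => if k = 0 then Set.univ else ∅, ?_, ?_, ?_⟩
    · ext x
      simp only [Set.mem_preimage, Set.mem_ofPred_eq, Set.mem_univ, Set.mem_iUnion, exists_const,
        true_iff]
      exact ⟨0, by simp⟩
    · intro k x _ y _
      exact hiso x y trivial trivial
    · intro k k' x hx y hy _ i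
      by_cases hk : k = 0 <;> by_cases hk' : k' = 0 <;> simp_all
  · refine ⟨fun k => {x | Φ x + latticeVec k ∈ C}, ?_, ?_, ?_⟩
    · ext x; simp
    · intro k x hx y hy
      have h := hiso (x + latticeVec k) (y + latticeVec k) (by rwa [heq]) (by rwa [heq])
      simpa [heq] using h
    · intro k k' x hx y hy hxy i
      have h := h0 (x + latticeVec k) (y + latticeVec k') (by rwa [heq]) (by rwa [heq])
      rw [heq, heq] at h
      set p := Φ x + latticeVec k
      set q := Φ y + latticeVec k'
      have hpq : ‖p - q‖ ≤ 4 * Real.pi := by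
        have hco : ∀ i, |(p - q) i| ≤ 2 * Real.pi := fun i => by
          have h1 := ha p hx i
          have h2 := ha q hy i
          rw [PiLp.sub_apply, abs_le]
          constructor <;> linarith [h1.1, h1.2, h2.1, h2.2]
        refine abs_le_of_sq_le_sq' ?_ (by positivity) |>.2
        rw [EuclideanSpace.norm_sq_eq, Fin.sum_univ_three]
        have h3 : ∀ i, ‖(p - q) i‖ ^ 2 ≤ (2 * Real.pi) ^ 2 := fun i => by
          gcongr; exact hco i
        nlinarith [h3 0, h3 1, h3 2]
      have hn : ‖latticeVec k - latticeVec k'‖ ≤ 1 + 8 / 7 * (4 * Real.pi) := by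
        have e1 : latticeVec k - latticeVec k' = -(x - y) + (p - q) +
            ((x + latticeVec k - (y + latticeVec k')) - (p - q)) := by abel
        rw [e1]
        refine (norm_add₃_le).trans ?_
        rw [norm_neg]
        nlinarith [norm_nonneg (p - q)]
      have e2 : latticeVec k - latticeVec k' = latticeVec (k - k') := by
        ext i; simp [latticeVec]; ring
      rw [e2] at hn
      have h4 := (norm_latticeVec_apply_le (k := k - k') i).trans hn
      have h5 : |((k - k') i : ℝ)| < 4 := by nlinarith
      have h6 : |k i - k' i| < 4 := by
        have : ((|k i - k' i| : ℤ) : ℝ) < (4 : ℤ) := by simpa using h5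
        exact_mod_cast this
      push_cast
      omega

/-- The region of the pipe with index `j`, pulled back by `Φ`. -/
def pipeRegion {ξ : Space} (F : RationalFrame ξ) (lam r : ℝ) (s : Plane) (Φ : Space → Space)
    (j : Fin 2 → ℤ) : Set Space :=
  {x | ‖pipeCoord F lam r s (Φ x) j‖ ≤ 1 / 4}

section pipeRegion

variable {ξ : Space} {F : RationalFrame ξ} {lam r : ℝ} {s : Plane} {Φ : Space → Space}
  {j j' : Fin 2 → ℤ} {x y : Space}

/-- The displacement transversal to the axis between two points in pipes of the same family is the
displacement of the pipes, up to the diameter of a pipe. -/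
theorem abs_inner_sub_index_le (hr : 0 < r) (hx : x ∈ pipeRegion F lam r s Φ j)
    (hy : y ∈ pipeRegion F lam r s Φ j') :
    |F.n * lam * r * inner ℝ (Φ x - Φ y) F.e₁ - 2 * Real.pi * (j 0 - j' 0 : ℝ)| ≤ Real.pi * r ∧
    |F.n * lam * r * inner ℝ (Φ x - Φ y) F.e₂ - 2 * Real.pi * (j 1 - j' 1 : ℝ)| ≤ Real.pi * r := by
  have h : ‖pipeCoord F lam r s (Φ x) j - pipeCoord F lam r s (Φ y) j'‖ ≤ 1 / 2 :=
    (norm_sub_le _ _).trans (by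
      rw [pipeRegion, Set.mem_ofPred_eq] at hx hy
      linarith)
  have h' := fun i => (PiLp.norm_apply_le _ i).trans h
  have h0 := h' 0
  have h1 := h' 1
  rw [pipeCoord, pipeCoord, ← smul_sub, PiLp.smul_apply, norm_smul,
    Real.norm_of_nonneg (by positivity), inv_mul_le_iff₀ (by positivity)] at h0 h1
  simp at h0 h1
  constructor
  · rw [inner_sub_left]
    refine le_trans (le_of_eq ?_) (h0.trans (by linarith))
    congr 1; ring
  · rw [inner_sub_left]
    refine le_trans (le_of_eq ?_) (h1.trans (by linarith))
    congr 1; ring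

theorem abs_index_sub_le (hr : 0 < r) (hr1 : r ≤ 1) (hlr : 0 < lam * r)
    (hx : x ∈ pipeRegion F lam r s Φ j) (hy : y ∈ pipeRegion F lam r s Φ j')
    (h : ‖Φ x - Φ y‖ ≤ 2 * (lam * r)⁻¹) (i : Fin 2) : |j i - j' i| ≤ (F.n : ℕ) := by
  have hpi := Real.pi_gt_three
  have hn : (1 : ℝ) ≤ F.n := by exact_mod_cast F.n_pos
  have key : ∀ e : Space, ‖e‖ = 1 → ∀ k : ℤ,
      |F.n * lam * r * inner ℝ (Φ x - Φ y) e - 2 * Real.pi * k| ≤ Real.pi * r → |k| ≤ F.n := by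
    intro e he k hk
    have h1 : |F.n * lam * r * inner ℝ (Φ x - Φ y) e| ≤ F.n * 2 := by
      have h2 : |inner ℝ (Φ x - Φ y) e| ≤ 2 * (lam * r)⁻¹ := by
        refine (abs_real_inner_le_norm _ _).trans ?_
        rwa [he, mul_one]
      rw [mul_assoc (F.n : ℝ), abs_mul, abs_mul, abs_of_pos hlr, abs_of_nonneg (by positivity)]
      calc (F.n : ℝ) * (lam * r) * |inner ℝ (Φ x - Φ y) e|
          ≤ F.n * (lam * r) * (2 * (lam * r)⁻¹) := by gcongr
        _ = F.n * 2 := by rw [mul_assoc, mul_left_comm (lam * r), mul_inv_cancel₀ hlr.ne', mul_one]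
    have h3 : |(k : ℝ)| < F.n + 1 := by
      rw [abs_le] at h1 hk
      rw [abs_lt]
      constructor <;> nlinarith
    have h4 : |k| < F.n + 1 := by exact_mod_cast h3
    omega
  obtain ⟨h0, h1⟩ := abs_inner_sub_index_le hr hx hy
  fin_cases i
  · exact key _ F.norm_e₁ _ (by push_cast; exact h0)
  · exact key _ F.norm_e₂ _ (by push_cast; exact h1)

theorem norm_sub_inner_smul_le_of_mem_pipeRegion (hr : 0 < r) (hlam : 0 < lam)
    (hx : x ∈ pipeRegion F lam r s Φ j) (hy : y ∈ pipeRegion F lam r s Φ j) :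
    ‖(Φ x - Φ y) - inner ℝ ξ (Φ x - Φ y) • ξ‖ ≤ 2 * Real.pi / lam := by
  have hn : (1 : ℝ) ≤ F.n := by exact_mod_cast F.n_pos
  have key : ∀ a : ℝ, |F.n * lam * r * a| ≤ Real.pi * r → |a| ≤ Real.pi / lam := by
    intro a ha
    rw [abs_mul, abs_of_pos (by positivity)] at ha
    rw [le_div_iff₀ hlam]
    have h1 : (F.n * lam * |a|) * r ≤ Real.pi * r := by linarith
    have h2 := le_of_mul_le_mul_right h1 hr
    have h3 : 0 ≤ lam * |a| := by positivity
    nlinarith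
  obtain ⟨h0, h1⟩ := abs_inner_sub_index_le hr hx hy
  simp only [sub_self, mul_zero, sub_zero] at h0 h1
  refine (F.norm_sub_inner_smul_le _).trans ?_
  have := key _ h0
  have := key _ h1
  rw [two_mul, add_div]
  linarith

end pipeRegion

/-- In a set of the size of the pipe spacing, the pipes of two transversal families intersect in a
set of volume `≲ lam⁻³`: boundedly many pipes of each family occur, and two pipes intersect in a set
of diameter `≲ lam⁻¹`. -/
theorem exists_volume_inter_pipeRegion_bound {ξ₁ ξ₂ : Space} (F₁ : RationalFrame ξ₁)
    (F₂ : RationalFrame ξ₂) {ε : ℝ} (hε : 0 < ε) (hε1 : ε ≤ 1)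
    (hang : |inner ℝ ξ₁ ξ₂| ≤ 1 - ε) :
    ∃ K : ℝ, 0 < K ∧ ∀ {lam r ell : ℝ}, 0 < lam → 0 < r → r ≤ 1 → 1 ≤ lam * r → 0 ≤ ell →
      ell ≤ ε ^ 3 / 8 → ∀ {Ω₁ Ω₂ : Set Space}, IsConvexNeighborhood Ω₁ → IsConvexNeighborhood Ω₂ →
      ∀ {Φ₁ X₁ Φ₂ X₂ : Space → Space}, ContDiff ℝ ∞ Φ₁ → ContDiff ℝ ∞ Φ₂ →
      (∀ x, X₁ (Φ₁ x) = x) → (∀ x, Φ₁ (X₁ x) = x) → (∀ x, X₂ (Φ₂ x) = x) → (∀ x, Φ₂ (X₂ x) = x) →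
      (∀ x k, Φ₁ (x + latticeVec k) = Φ₁ x + latticeVec k) →
      (∀ x k, Φ₂ (x + latticeVec k) = Φ₂ x + latticeVec k) →
      (∀ x, Φ₁ x ∈ Ω₁ → ‖fderiv ℝ Φ₁ x - ContinuousLinearMap.id ℝ Space‖ ≤ ell) →
      (∀ x, Φ₂ x ∈ Ω₂ → ‖fderiv ℝ Φ₂ x - ContinuousLinearMap.id ℝ Space‖ ≤ ell) →
      ∀ (s₁ s₂ : Plane) (Q : Set Space), (∀ x ∈ Q, ∀ y ∈ Q, ‖x - y‖ ≤ (lam * r)⁻¹) →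
      MeasureTheory.volume (Q ∩ (Φ₁ ⁻¹' Ω₁) ∩ (Φ₂ ⁻¹' Ω₂) ∩ (⋃ j, pipeRegion F₁ lam r s₁ Φ₁ j) ∩
        ⋃ j, pipeRegion F₂ lam r s₂ Φ₂ j) ≤ ENNReal.ofReal (K * (lam ^ 3)⁻¹) := by
  set V := (MeasureTheory.volume (Metric.ball (0 : Space) 1)).toReal
  have hV0 : 0 ≤ V := ENNReal.toReal_nonneg
  set N₁ : ℕ := (2 * F₁.n + 1) ^ 2
  set N₂ : ℕ := (2 * F₂.n + 1) ^ 2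
  refine ⟨7 ^ 3 * (7 ^ 3 * (N₁ * (N₂ * (V * (12 * Real.pi / ε) ^ 3)))) + 1, by positivity, ?_⟩
  intro lam r ell hlam hr hr1 hlr hell0 hell Ω₁ Ω₂ hΩ₁ hΩ₂ Φ₁ X₁ Φ₂ X₂ hΦ₁ hΦ₂ hXΦ₁ hΦX₁ hXΦ₂ hΦX₂
    heq₁ heq₂ hb₁ hb₂ s₁ s₂ Q hQ
  have hε3 : ε ^ 3 ≤ 1 := pow_le_one₀ hε.le hε1
  have hε2 : ε ^ 3 ≤ ε := pow_le_of_le_one hε.le hε1 (by norm_num)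
  have hlr1 : (lam * r)⁻¹ ≤ 1 := inv_le_one_of_one_le₀ hlr
  obtain ⟨S₁, hS₁, hiso₁, hnear₁⟩ := hΩ₁.exists_almost_isometric_pieces hell0 (by linarith) hΦ₁ hXΦ₁
    hΦX₁ heq₁ hb₁
  obtain ⟨S₂, hS₂, hiso₂, hnear₂⟩ := hΩ₂.exists_almost_isometric_pieces hell0 (by linarith) hΦ₂ hXΦ₂
    hΦX₂ heq₂ hb₂
  have hlip : ∀ {a w : Space}, ‖w - a‖ ≤ 4 / 3 * ell * ‖w‖ → ‖w‖ ≤ (lam * r)⁻¹ →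
      ‖a‖ ≤ 2 * (lam * r)⁻¹ := by
    intro a w h hw
    have h1 : ‖a‖ ≤ ‖w‖ + ‖w - a‖ := by
      have := norm_sub_le w (w - a)
      rwa [sub_sub_cancel] at this
    nlinarith [norm_nonneg w]
  rw [hS₁, hS₂]
  have hfin : ∀ k₁ k₂ j₁ j₂, MeasureTheory.volume
      (Q ∩ S₁ k₁ ∩ S₂ k₂ ∩ pipeRegion F₁ lam r s₁ Φ₁ j₁ ∩
      pipeRegion F₂ lam r s₂ Φ₂ j₂) ≤ ENNReal.ofReal (V * (12 * Real.pi / ε / lam) ^ 3) := by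
    intro k₁ k₂ j₁ j₂
    refine measure_le_of_norm_sub_le (by positivity) ?_
    rintro x ⟨⟨⟨⟨hxQ, hx1⟩, hx2⟩, hx3⟩, hx4⟩ y ⟨⟨⟨⟨hyQ, hy1⟩, hy2⟩, hy3⟩, hy4⟩
    have hi1 := hiso₁ _ x hx1 y hy1
    have hi2 := hiso₂ _ x hx2 y hy2
    have hp1 := norm_sub_inner_smul_le_of_mem_pipeRegion hr hlam hx3 hy3
    have hp2 := norm_sub_inner_smul_le_of_mem_pipeRegion hr hlam hx4 hy4
    have tri : ∀ {w a b : Space} {R R' : ℝ}, ‖w - a‖ ≤ R → ‖a - b‖ ≤ R' → ‖w - b‖ ≤ R' + R := by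
      intro w a b R R' h h'
      have := norm_add_le (w - a) (a - b)
      rw [sub_add_sub_cancel] at this
      linarith
    have hw := norm_le_of_close_to_two_lines F₁.norm_axis F₂.norm_axis hε hε1 hang
      (tri hi1 hp1) (tri hi2 hp2)
    -- the deformation error is absorbed in the left-hand side
    have habs : 3 / ε * (4 / 3 * ell * ‖x - y‖) ≤ 1 / 2 * ‖x - y‖ := by
      rw [div_mul_eq_mul_div, div_le_iff₀ hε]
      nlinarith [mul_le_mul_of_nonneg_right (hell.trans (by linarith : ε ^ 3 / 8 ≤ ε / 8))
        (norm_nonneg (x - y))]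
    have e : 12 * Real.pi / ε / lam = 2 * (3 / ε * (2 * Real.pi / lam)) := by
      field_simp; norm_num
    rw [e]
    rw [mul_add] at hw
    linarith
  set P₁ := ⋃ j, pipeRegion F₁ lam r s₁ Φ₁ j
  set P₂ := ⋃ j, pipeRegion F₂ lam r s₂ Φ₂ j
  -- the pieces and the pipes are fixed one by one, and the indices which occur are counted
  have hpipes₂ : ∀ k₁ k₂ j₁,
      MeasureTheory.volume (Q ∩ S₁ k₁ ∩ S₂ k₂ ∩ pipeRegion F₁ lam r s₁ Φ₁ j₁ ∩ P₂) ≤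
        N₂ * ENNReal.ofReal (V * (12 * Real.pi / ε / lam) ^ 3) := by
    intro k₁ k₂ j₁
    refine measure_inter_iUnion_le_of_index_close _ _ _ F₂.n _ ?_ (hfin k₁ k₂ j₁)
    rintro j j' x ⟨⟨⟨⟨hxQ, hx1⟩, hx2⟩, hx3⟩, hx4⟩ y ⟨⟨⟨⟨hyQ, hy1⟩, hy2⟩, hy3⟩, hy4⟩ i
    exact abs_index_sub_le hr hr1 (by linarith) hx4 hy4
      (hlip (hiso₂ _ x hx2 y hy2) (hQ x hxQ y hyQ)) i
  have hpipes₁ : ∀ k₁ k₂, MeasureTheory.volume (Q ∩ S₁ k₁ ∩ S₂ k₂ ∩ P₁ ∩ P₂) ≤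
      N₁ * (N₂ * ENNReal.ofReal (V * (12 * Real.pi / ε / lam) ^ 3)) := by
    intro k₁ k₂
    rw [Set.inter_right_comm]
    refine measure_inter_iUnion_le_of_index_close _ _ _ F₁.n _ ?_
      fun j => by rw [Set.inter_right_comm]; exact hpipes₂ k₁ k₂ j
    rintro j j' x ⟨⟨⟨⟨hxQ, hx1⟩, hx2⟩, hx3⟩, hx4⟩ y ⟨⟨⟨⟨hyQ, hy1⟩, hy2⟩, hy3⟩, hy4⟩ i
    exact abs_index_sub_le hr hr1 (by linarith) hx4 hy4
      (hlip (hiso₁ _ x hx1 y hy1) (hQ x hxQ y hyQ)) i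
  have hpieces₂ : ∀ k₁, MeasureTheory.volume (Q ∩ P₁ ∩ P₂ ∩ S₁ k₁ ∩ ⋃ k, S₂ k) ≤
      ((2 * 3 + 1) ^ 3 : ℕ) *
        (N₁ * (N₂ * ENNReal.ofReal (V * (12 * Real.pi / ε / lam) ^ 3))) := by
    intro k₁
    refine measure_inter_iUnion_le_of_index_close _ _ _ 3 _ ?_ fun k => ?_
    · rintro k k' x ⟨⟨⟨⟨hxQ, _⟩, _⟩, _⟩, hx⟩ y ⟨⟨⟨⟨hyQ, _⟩, _⟩, _⟩, hy⟩ i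
      exact hnear₂ k k' x hx y hy ((hQ x hxQ y hyQ).trans hlr1) i
    · refine le_of_eq_of_le (congrArg _ ?_) (hpipes₁ k₁ k)
      ext; simp only [Set.mem_inter_iff]; tauto
  have hpieces₁ : MeasureTheory.volume (Q ∩ P₁ ∩ P₂ ∩ (⋃ k, S₂ k) ∩ ⋃ k, S₁ k) ≤
      ((2 * 3 + 1) ^ 3 : ℕ) * (((2 * 3 + 1) ^ 3 : ℕ) *
        (N₁ * (N₂ * ENNReal.ofReal (V * (12 * Real.pi / ε / lam) ^ 3)))) := by
    refine measure_inter_iUnion_le_of_index_close _ _ _ 3 _ ?_ fun k => ?_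
    · rintro k k' x ⟨⟨⟨⟨hxQ, _⟩, _⟩, _⟩, hx⟩ y ⟨⟨⟨⟨hyQ, _⟩, _⟩, _⟩, hy⟩ i
      exact hnear₁ k k' x hx y hy ((hQ x hxQ y hyQ).trans hlr1) i
    · rw [Set.inter_right_comm]; exact hpieces₂ k
  refine le_of_eq_of_le (congrArg _ ?_) (hpieces₁.trans ?_)
  · ext; simp only [Set.mem_inter_iff]; tauto
  · rw [← ENNReal.ofReal_natCast, ← ENNReal.ofReal_natCast N₁, ← ENNReal.ofReal_natCast N₂]
    repeat rw [← ENNReal.ofReal_mul (by positivity)]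
    apply ENNReal.ofReal_le_ofReal
    rw [add_mul, div_pow _ lam, div_eq_mul_inv _ (lam ^ 3)]
    have : 0 ≤ 1 * (lam ^ 3)⁻¹ := by positivity
    push_cast
    refine le_trans (le_of_eq ?_) (le_add_of_nonneg_right this)
    norm_num
    ring

/-! ### The Sobolev inequality on cubes -/

/-- The one-dimensional Sobolev inequality: the supremum on an interval is bounded by the mean value
and the total variation. -/
theorem enorm_le_lintegral_Ico {F : Type*} [NormedAddCommGroup F] [NormedSpace ℝ F]
    [CompleteSpace F] {a h : ℝ} (hh : 0 < h) {g g' : ℝ → F}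
    (hg : ∀ s ∈ Set.Ico a (a + h), HasDerivAt g (g' s) s)
    (hg' : ContinuousOn g' (Set.Ico a (a + h))) {x : ℝ} (hx : x ∈ Set.Ico a (a + h)) :
    ‖g x‖ₑ ≤ ∫⁻ s in Set.Ico a (a + h), (ENNReal.ofReal h⁻¹ * ‖g s‖ₑ + ‖g' s‖ₑ) := by
  set I := ∫⁻ s in Set.Ico a (a + h), ‖g' s‖ₑ
  have hgc : ContinuousOn g (Set.Ico a (a + h)) :=
    fun s hs => (hg s hs).continuousAt.continuousWithinAt
  have hmeas : AEMeasurable (fun s => ENNReal.ofReal h⁻¹ * ‖g s‖ₑ)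
      (MeasureTheory.volume.restrict (Set.Ico a (a + h))) :=
    ((hgc.aestronglyMeasurable measurableSet_Ico).enorm).const_mul _
  rw [MeasureTheory.lintegral_add_left' hmeas, MeasureTheory.lintegral_const_mul' _ _ (by simp)]
  have hpt : ∀ s ∈ Set.Ico a (a + h), ‖g x‖ₑ ≤ ‖g s‖ₑ + I := by
    intro s hs
    have hsub : Set.uIcc s x ⊆ Set.Ico a (a + h) :=
      (Set.ordConnected_Ico.uIcc_subset hs hx)
    have hftc : ∫ y in s..x, g' y = g x - g s :=
      intervalIntegral.integral_eq_sub_of_hasDerivAt (fun y hy => hg y (hsub hy))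
        (hg'.mono hsub).intervalIntegrable
    have h1 : ‖g x - g s‖ₑ ≤ I := by
      rw [← hftc, ← ofReal_norm, intervalIntegral.norm_intervalIntegral_eq,
        ofReal_norm]
      refine (MeasureTheory.enorm_integral_le_lintegral_enorm _).trans ?_
      exact MeasureTheory.lintegral_mono_set (Set.uIoc_subset_uIcc.trans hsub)
    calc ‖g x‖ₑ = ‖g s + (g x - g s)‖ₑ := by rw [add_sub_cancel]
      _ ≤ ‖g s‖ₑ + ‖g x - g s‖ₑ := enorm_add_le _ _
      _ ≤ _ := by gcongr
  have hvol : MeasureTheory.volume (Set.Ico a (a + h)) = ENNReal.ofReal h := by simp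
  have hmean : ENNReal.ofReal h * ‖g x‖ₑ ≤
      (∫⁻ s in Set.Ico a (a + h), ‖g s‖ₑ) + ENNReal.ofReal h * I := by
    have h2 := MeasureTheory.setLIntegral_mono' (μ := MeasureTheory.volume) measurableSet_Ico hpt
    rw [MeasureTheory.lintegral_add_right _ measurable_const] at h2
    simp only [MeasureTheory.lintegral_const, MeasureTheory.Measure.restrict_apply_univ, hvol] at h2
    rwa [mul_comm, mul_comm (ENNReal.ofReal h) I]
  have hc : ENNReal.ofReal h⁻¹ * ENNReal.ofReal h = 1 := by
    rw [← ENNReal.ofReal_mul (by positivity), inv_mul_cancel₀ hh.ne', ENNReal.ofReal_one]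
  calc ‖g x‖ₑ = ENNReal.ofReal h⁻¹ * (ENNReal.ofReal h * ‖g x‖ₑ) := by rw [← mul_assoc, hc, one_mul]
    _ ≤ ENNReal.ofReal h⁻¹ * ((∫⁻ s in Set.Ico a (a + h), ‖g s‖ₑ) + ENNReal.ofReal h * I) := by
        gcongr
    _ = _ := by rw [mul_add, ← mul_assoc, hc, one_mul]

/-- The half-open cube with lowest corner `a` and side `h`. -/
def cube (a : Fin 3 → ℝ) (h : ℝ) : Set Space :=
  {x | ∀ i, x i ∈ Set.Ico (a i) (a i + h)}

theorem cube_eq_preimage (a : Fin 3 → ℝ) (h : ℝ) :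
    cube a h = WithLp.ofLp ⁻¹' (Set.univ.pi fun i => Set.Ico (a i) (a i + h)) := by
  ext x; simp [cube]

theorem measurableSet_cube (a : Fin 3 → ℝ) (h : ℝ) : MeasurableSet (cube a h) := by
  rw [cube_eq_preimage]
  exact (PiLp.volume_preserving_ofLp (Fin 3)).measurable
    (MeasurableSet.univ_pi fun i => measurableSet_Ico)

theorem norm_sub_le_of_mem_cube {a : Fin 3 → ℝ} {h : ℝ} {x y : Space} (hx : x ∈ cube a h)
    (hy : y ∈ cube a h) : ‖x - y‖ ≤ 2 * h := by
  have hh : 0 ≤ h := by linarith [(hx 0).1, (hx 0).2]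
  have hco : ∀ i, |(x - y) i| ≤ h := fun i => by
    have h1 := hx i
    have h2 := hy i
    rw [PiLp.sub_apply, abs_le]
    constructor <;> linarith [h1.1, h1.2, h2.1, h2.2]
  refine abs_le_of_sq_le_sq' ?_ (by positivity) |>.2
  rw [EuclideanSpace.norm_sq_eq, Fin.sum_univ_three]
  have h3 : ∀ i, ‖(x - y) i‖ ^ 2 ≤ h ^ 2 := fun i => by
    gcongr; exact hco i
  nlinarith [h3 0, h3 1, h3 2]

/-- Restriction to a cube of the norm of the `n`-th derivative of `f`, as a function of the
coordinates. -/
noncomputable def cubeDerivNorm (f : Space → ℝ) (a : Fin 3 → ℝ) (h : ℝ) (n : ℕ) :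
    (Fin 3 → ℝ) → ENNReal :=
  (Set.univ.pi fun i => Set.Ico (a i) (a i + h)).indicator
    fun y => ‖iteratedFDeriv ℝ n f (WithLp.toLp 2 y)‖ₑ

section cubeDerivNorm

variable {f : Space → ℝ} {a : Fin 3 → ℝ} {h : ℝ}

theorem measurable_cubeDerivNorm (hf : ∀ x ∈ cube a h, ContDiffAt ℝ 3 f x) {n : ℕ} (hn : n ≤ 3) :
    Measurable (cubeDerivNorm f a h n) := by
  classical
  rw [cubeDerivNorm, ← Set.piecewise_eq_indicator]
  refine ContinuousOn.measurable_piecewise ?_ continuousOn_const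
    (MeasurableSet.univ_pi fun i => measurableSet_Ico)
  intro y hy
  have h1 : ContDiffAt ℝ 0 (iteratedFDeriv ℝ n f) (WithLp.toLp 2 y) :=
    (hf (WithLp.toLp 2 y) (by rw [cube_eq_preimage]; exact hy)).iteratedFDeriv_right
      (by rw [zero_add]; exact_mod_cast hn)
  exact (ContinuousAt.comp (g := iteratedFDeriv ℝ n f) (f := WithLp.toLp 2) h1.continuousAt
    (PiLp.continuous_toLp 2 _).continuousAt).enorm.continuousWithinAt

/-- The one-dimensional Sobolev inequality in the direction of the `i`-th axis. -/
theorem cubeDerivNorm_le_lmarginal (hh : 0 < h) (hf : ∀ x ∈ cube a h, ContDiffAt ℝ 3 f x) {n : ℕ}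
    (hn : n ≤ 2) (i : Fin 3) :
    cubeDerivNorm f a h n ≤ MeasureTheory.lmarginal
      (fun i => MeasureTheory.volume.restrict (Set.Ico (a i) (a i + h))) {i}
      (fun y => ENNReal.ofReal h⁻¹ * cubeDerivNorm f a h n y + cubeDerivNorm f a h (n + 1) y) := by
  intro y
  rw [MeasureTheory.lmarginal_singleton]
  by_cases hy : y ∈ Set.univ.pi fun i => Set.Ico (a i) (a i + h)
  swap
  · simp [cubeDerivNorm, Set.indicator_of_notMem hy]
  have hup : ∀ s ∈ Set.Ico (a i) (a i + h),
      Function.update y i s ∈ Set.univ.pi fun i => Set.Ico (a i) (a i + h) := by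
    intro s hs k _
    by_cases hk : k = i
    · subst hk; simpa using hs
    · simpa [hk] using hy k trivial
  set p : ℝ → Space := fun s => WithLp.toLp 2 (Function.update y i s) with hp
  have hpeq : ∀ s, p s = WithLp.toLp 2 y + (s - y i) • EuclideanSpace.single i (1 : ℝ) := by
    intro s; ext k
    by_cases hk : k = i
    · subst hk; simp [hp]
    · simp [hp, hk]
  have hpd : ∀ s, HasDerivAt p (EuclideanSpace.single i (1 : ℝ)) s := by
    intro s
    rw [funext hpeq]
    simpa using (((hasDerivAt_id s).sub_const (y i)).smul_const
      (EuclideanSpace.single i (1 : ℝ))).const_add (WithLp.toLp 2 y)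
  have hpc : Continuous p := by
    rw [funext hpeq]; fun_prop
  have hcd : ∀ s ∈ Set.Ico (a i) (a i + h), ContDiffAt ℝ 1 (iteratedFDeriv ℝ n f) (p s) :=
    fun s hs => (hf (p s) (by rw [cube_eq_preimage]; exact hup s hs)).iteratedFDeriv_right
      (by rw [add_comm]; exact_mod_cast Nat.succ_le_succ hn)
  have hyi : y i ∈ Set.Ico (a i) (a i + h) := hy i trivial
  have key := enorm_le_lintegral_Ico hh (g := fun s => iteratedFDeriv ℝ n f (p s))
    (g' := fun s => fderiv ℝ (iteratedFDeriv ℝ n f) (p s) (EuclideanSpace.single i (1 : ℝ)))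
    (fun s hs => ((hcd s hs).differentiableAt (by simp)).hasFDerivAt.comp_hasDerivAt s (hpd s))
    (fun s hs => by
      have h1 : ContDiffAt ℝ 0 (fderiv ℝ (iteratedFDeriv ℝ n f)) (p s) :=
        (hcd s hs).fderiv_right (by simp)
      have h2 : ContinuousAt (fun s => fderiv ℝ (iteratedFDeriv ℝ n f) (p s)) s :=
        ContinuousAt.comp (g := fderiv ℝ (iteratedFDeriv ℝ n f)) h1.continuousAt hpc.continuousAt
      exact (h2.clm_apply continuousAt_const).continuousWithinAt) hyi
  have hpy : p (y i) = WithLp.toLp 2 y := by simp [hp]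
  rw [cubeDerivNorm, Set.indicator_of_mem hy, ← hpy]
  refine key.trans (MeasureTheory.setLIntegral_mono' measurableSet_Ico fun s hs => ?_)
  simp only [cubeDerivNorm, Set.indicator_of_mem (hup s hs)]
  gcongr
  rw [← ofReal_norm, ← ofReal_norm]
  apply ENNReal.ofReal_le_ofReal
  rw [← norm_fderiv_iteratedFDeriv]
  refine (ContinuousLinearMap.le_opNorm _ _).trans ?_
  simp [hp]

/-- The `n`-th term of the sequence which results from `G` by `k` applications of the operator
`G ↦ c G + G (· + 1)`.  This is what bounds the `n`-th derivative after integration of `k` of the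
coordinates as in `cubeDerivNorm_le_lmarginal`. -/
noncomputable def sobolevSum {α : Type*} (c : ENNReal) (G : ℕ → α → ENNReal) :
    ℕ → ℕ → α → ENNReal
  | 0, n => G n
  | k + 1, n => fun y => c * sobolevSum c G k n y + sobolevSum c G k (n + 1) y

theorem measurable_sobolevSum {α : Type*} [MeasurableSpace α] {c : ENNReal} {G : ℕ → α → ENNReal}
    {N : ℕ} (hG : ∀ n ≤ N, Measurable (G n)) (k n : ℕ) (h : n + k ≤ N) :
    Measurable (sobolevSum c G k n) := by
  induction k generalizing n with
  | zero => exact hG n h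
  | succ k ih => exact ((ih n (by omega)).const_mul _).add (ih (n + 1) (by omega))

theorem sobolevSum_le_lmarginal {ι : Type*} [DecidableEq ι] {X : ι → Type*}
    [∀ i, MeasurableSpace (X i)] (μ : ∀ i, MeasureTheory.Measure (X i))
    [∀ i, MeasureTheory.SigmaFinite (μ i)] {c : ENNReal} {G : ℕ → (∀ i, X i) → ENNReal} {N : ℕ}
    (hc : c ≠ ⊤) (hG : ∀ n ≤ N + 1, Measurable (G n)) (i : ι)
    (h : ∀ n ≤ N, G n ≤ MeasureTheory.lmarginal μ {i} (fun y => c * G n y + G (n + 1) y))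
    (k n : ℕ) (hk : n + k ≤ N) :
    sobolevSum c G k n ≤ MeasureTheory.lmarginal μ {i} (sobolevSum c G (k + 1) n) := by
  induction k generalizing n with
  | zero => exact h n hk
  | succ k ih =>
    intro y
    have h1 := ih n (by omega) y
    have h2 := ih (n + 1) (by omega) y
    have hm := measurable_sobolevSum (c := c) hG (k + 1) n (by omega)
    rw [MeasureTheory.lmarginal_singleton] at h1 h2 ⊢
    change _ ≤ ∫⁻ t, (c * sobolevSum c G (k + 1) n (Function.update y i t) +
      sobolevSum c G (k + 1) (n + 1) (Function.update y i t)) ∂μ i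
    have hm' : Measurable fun t => c * sobolevSum c G (k + 1) n (Function.update y i t) :=
      (hm.comp (measurable_update y)).const_mul _
    rw [MeasureTheory.lintegral_add_left hm', MeasureTheory.lintegral_const_mul' _ _ hc]
    exact add_le_add (mul_le_mul_right h1 c) h2

theorem lintegral_sobolevSum {α : Type*} [MeasurableSpace α] (μ : MeasureTheory.Measure α)
    {c : ENNReal} {G : ℕ → α → ENNReal} {N : ℕ} (hc : c ≠ ⊤) (hG : ∀ n ≤ N, Measurable (G n))
    (k n : ℕ) (h : n + k ≤ N) :
    ∫⁻ y, sobolevSum c G k n y ∂μ = sobolevSum c (fun n (_ : Unit) => ∫⁻ y, G n y ∂μ) k n () := by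
  induction k generalizing n with
  | zero => rfl
  | succ k ih =>
    have hm := measurable_sobolevSum (c := c) hG k n (by omega)
    simp only [sobolevSum]
    rw [MeasureTheory.lintegral_add_left (hm.const_mul _),
      MeasureTheory.lintegral_const_mul' _ _ hc, ih n (by omega), ih (n + 1) (by omega)]

theorem lintegral_cubeDerivNorm (n : ℕ) :
    ∫⁻ y, cubeDerivNorm f a h n y
        ∂(MeasureTheory.Measure.pi fun i =>
          MeasureTheory.volume.restrict (Set.Ico (a i) (a i + h))) =
      ∫⁻ x in cube a h, ‖iteratedFDeriv ℝ n f x‖ₑ := by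
  have hms : MeasurableSet (Set.univ.pi fun i => Set.Ico (a i) (a i + h)) :=
    MeasurableSet.univ_pi fun i => measurableSet_Ico
  rw [← MeasureTheory.Measure.restrict_pi_pi, cubeDerivNorm,
    MeasureTheory.setLIntegral_indicator hms, Set.inter_self, cube_eq_preimage]
  exact ((PiLp.volume_preserving_ofLp (Fin 3)).setLIntegral_comp_preimage_emb
    (MeasurableEquiv.toLp 2 (Fin 3 → ℝ)).symm.measurableEmbedding
    (fun y => ‖iteratedFDeriv ℝ n f (WithLp.toLp 2 y)‖ₑ) _).symm

/-- The Sobolev embedding of `W^{3,1}` into `L^∞` on a cube in three dimensions. -/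
theorem enorm_le_sum_lintegral_cube (hh : 0 < h) (hf : ∀ x ∈ cube a h, ContDiffAt ℝ 3 f x)
    {x : Space} (hx : x ∈ cube a h) :
    ‖f x‖ₑ ≤ ∑ n ∈ Finset.range 4, ENNReal.ofReal (3 * (h⁻¹) ^ (3 - n)) *
      ∫⁻ y in cube a h, ‖iteratedFDeriv ℝ n f y‖ₑ := by
  set μ : Fin 3 → MeasureTheory.Measure ℝ :=
    fun i => MeasureTheory.volume.restrict (Set.Ico (a i) (a i + h)) with hμ
  set c := ENNReal.ofReal h⁻¹ with hc
  set G := cubeDerivNorm f a h with hG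
  have hGm : ∀ n ≤ 2 + 1, Measurable (G n) := fun n hn => measurable_cubeDerivNorm hf hn
  have hstep := fun i => sobolevSum_le_lmarginal μ (c := c) ENNReal.ofReal_ne_top hGm i
    fun n hn => cubeDerivNorm_le_lmarginal hh hf hn i
  have hSm : Measurable (sobolevSum c G 3 0) := measurable_sobolevSum hGm 3 0 (by omega)
  have h3 : G 0 ≤ MeasureTheory.lmarginal μ Finset.univ (sobolevSum c G 3 0) := by
    have e : (Finset.univ : Finset (Fin 3)) = {0} ∪ ({1} ∪ {2}) := by decide
    rw [e, MeasureTheory.lmarginal_union μ _ hSm (by decide),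
      MeasureTheory.lmarginal_union μ _ hSm (by decide)]
    exact (hstep 0 0 0 (by omega)).trans (MeasureTheory.lmarginal_mono
      ((hstep 1 1 0 (by omega)).trans (MeasureTheory.lmarginal_mono (hstep 2 2 0 (by omega)))))
  have h4 := h3 (WithLp.ofLp x)
  rw [MeasureTheory.lmarginal_univ, lintegral_sobolevSum _ ENNReal.ofReal_ne_top hGm 3 0 (by omega),
    hG, cubeDerivNorm, Set.indicator_of_mem (by rw [cube_eq_preimage] at hx; exact hx)] at h4
  have h5 : ‖iteratedFDeriv ℝ 0 f (WithLp.toLp 2 (WithLp.ofLp x))‖ₑ = ‖f x‖ₑ := by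
    rw [← ofReal_norm, ← ofReal_norm, norm_iteratedFDeriv_zero]
  rw [h5] at h4
  refine h4.trans ?_
  simp only [sobolevSum, hμ, lintegral_cubeDerivNorm, Finset.sum_range_succ, Finset.sum_range_zero,
    zero_add]
  have h6 : ∀ k, ENNReal.ofReal (3 * h⁻¹ ^ k) = 3 * c ^ k := fun k => by
    rw [ENNReal.ofReal_mul (by norm_num), ENNReal.ofReal_pow (by positivity),
      ENNReal.ofReal_ofNat]
  simp only [h6]
  set J : ℕ → ENNReal := fun n => ∫⁻ x in cube a h, ‖iteratedFDeriv ℝ n f x‖ₑ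
  change c * (c * (c * J 0 + J 1) + (c * J 1 + J 2)) + (c * (c * J 1 + J 2) + (c * J 2 + J 3)) ≤
    3 * c ^ 3 * J 0 + 3 * c ^ 2 * J 1 + 3 * c ^ 1 * J 2 + 3 * c ^ 0 * J 3
  have h7 : 3 * c ^ 3 * J 0 + 3 * c ^ 2 * J 1 + 3 * c ^ 1 * J 2 + 3 * c ^ 0 * J 3 =
      (c * (c * (c * J 0 + J 1) + (c * J 1 + J 2)) + (c * (c * J 1 + J 2) + (c * J 2 + J 3))) +
        (2 * c ^ 3 * J 0 + 2 * J 3) := by ring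
  rw [h7]
  exact le_self_add

end cubeDerivNorm

/-! ### Functions concentrated at the scale of the pipes -/

/-- The lowest corner of the cube with index `k` in the division of the torus into `M ^ 3` cubes. -/
noncomputable def gridCorner (M : ℕ) (k : Fin 3 → Fin M) : Fin 3 → ℝ :=
  fun i => 2 * Real.pi / M * (k i : ℕ)

theorem torusCell_subset_iUnion_cube {M : ℕ} (hM : 0 < M) :
    torusCell ⊆ ⋃ k, cube (gridCorner M k) (2 * Real.pi / M) := by
  intro x hx
  have hM' : (0 : ℝ) < M := by exact_mod_cast hM
  have hh : 0 < 2 * Real.pi / M := by positivity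
  have hlt : ∀ i, ⌊x i / (2 * Real.pi / M)⌋₊ < M := fun i => by
    rw [Nat.floor_lt (div_nonneg (hx i).1 hh.le), div_lt_iff₀ hh, mul_div_cancel₀ _ hM'.ne']
    exact (hx i).2
  refine Set.mem_iUnion.2 ⟨fun i => ⟨_, hlt i⟩, fun i => ?_⟩
  have h1 := Nat.floor_le (div_nonneg (hx i).1 hh.le)
  have h2 := Nat.lt_floor_add_one (x i / (2 * Real.pi / M))
  rw [le_div_iff₀ hh] at h1
  rw [div_lt_iff₀ hh] at h2
  constructor
  · simp only [gridCorner]; linarith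
  · simp only [gridCorner]; linarith

theorem cube_gridCorner_subset_torusCell {M : ℕ} (k : Fin 3 → Fin M) :
    cube (gridCorner M k) (2 * Real.pi / M) ⊆ torusCell := by
  intro x hx i
  have hM' : (0 : ℝ) < M := by exact_mod_cast (k 0).pos
  have hh : 0 < 2 * Real.pi / M := by positivity
  have h := hx i
  simp only [gridCorner, Set.mem_Ico] at h
  have hk : ((k i : ℕ) : ℝ) + 1 ≤ M := by exact_mod_cast (k i).isLt
  refine ⟨le_trans (by positivity) h.1, h.2.trans_le ?_⟩
  calc 2 * Real.pi / M * (k i : ℕ) + 2 * Real.pi / M = 2 * Real.pi / M * ((k i : ℕ) + 1) := by ring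
    _ ≤ 2 * Real.pi / M * M := by gcongr
    _ = 2 * Real.pi := div_mul_cancel₀ _ hM'.ne'

theorem pairwise_disjoint_cube_gridCorner (M : ℕ) :
    Pairwise (Function.onFun Disjoint fun k => cube (gridCorner M k) (2 * Real.pi / M)) := by
  intro k k' hne
  refine Set.disjoint_left.2 fun x hx hx' => hne (funext fun i => Fin.ext ?_)
  have hM' : (0 : ℝ) < M := by exact_mod_cast (k 0).pos
  have hh : 0 < 2 * Real.pi / M := by positivity
  have h := hx i
  have h' := hx' i
  simp only [gridCorner, Set.mem_Ico] at h h'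
  have h1 : ((k i : ℕ) : ℝ) < (k' i : ℕ) + 1 := by
    refine lt_of_mul_lt_mul_left (a := 2 * Real.pi / M) ?_ hh.le
    linarith
  have h2 : ((k' i : ℕ) : ℝ) < (k i : ℕ) + 1 := by
    refine lt_of_mul_lt_mul_left (a := 2 * Real.pi / M) ?_ hh.le
    linarith
  have h1' : (k i : ℕ) < (k' i : ℕ) + 1 := by exact_mod_cast h1
  have h2' : (k' i : ℕ) < (k i : ℕ) + 1 := by exact_mod_cast h2
  omega

/-- The `L¹` norm of a function dominated by a multiple of `f` and concentrated on a set `P` which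
occupies at most the volume `B` of every set of diameter `(lam * r)⁻¹`: on a cube of that size `f` is
bounded by its Sobolev norm, and the sum over the cubes restores the `L¹` norms over the torus.
Since `f` varies at the longer scale `(lam * r₁)⁻¹`, its derivatives cost no more than `f` itself. -/
theorem torusL1Norm_le_of_concentrated {S P : Set Space} (hS : IsOpen S) {lam r₁ r : ℝ} {μ : ℕ}
    (hμ : 0 < μ) (hlr : lam * r = μ) (hr : 0 < r) (hr₁ : 0 ≤ r₁) (hr₁r : r₁ ≤ r)
    {f g : Space → ℝ} {Cf A B : ℝ} (hCf : 0 ≤ Cf) (hA : 0 ≤ A) (hB : 0 ≤ B)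
    (hf : ContDiffOn ℝ 3 f (Metric.thickening (lam * r)⁻¹ S))
    (hfn : ∀ n ≤ 3, torusL1Norm (Metric.thickening (lam * r)⁻¹ S)
      (fun x => ‖iteratedFDeriv ℝ n f x‖) ≤ ENNReal.ofReal (Cf * (lam * r₁) ^ n))
    (hg : ∀ x ∈ S, g x ≤ |f x| * A) (hg0 : ∀ x ∈ S, x ∉ P → g x ≤ 0)
    (hP : ∀ Q : Set Space, (∀ x ∈ Q, ∀ y ∈ Q, ‖x - y‖ ≤ (lam * r)⁻¹) →
      MeasureTheory.volume (Q ∩ S ∩ P) ≤ ENNReal.ofReal B) :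
    torusL1Norm S g ≤ ENNReal.ofReal (A * B * (324 * (lam * r) ^ 3 * Cf)) := by
  have hpi := Real.pi_gt_three
  have hpi4 := Real.pi_lt_four
  have hμ' : (0 : ℝ) < μ := by exact_mod_cast hμ
  have hlam : 0 < lam := by
    by_contra h
    nlinarith
  set N := Metric.thickening (lam * r)⁻¹ S
  have hNo : IsOpen N := Metric.isOpen_thickening
  -- with `16 * μ` cubes along each period, a cube has diameter below `(lam * r)⁻¹`,
  -- so one which meets `S` lies in the neighbourhood `N`
  set M : ℕ := 16 * μ with hM
  have hM0 : 0 < M := by omega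
  set h : ℝ := 2 * Real.pi / M with hh
  have hMr : (M : ℝ) = 16 * (lam * r) := by rw [hM, hlr]; push_cast; ring
  have hlr0 : 0 < lam * r := by rw [hlr]; exact hμ'
  have hh' : h = Real.pi / 8 * (lam * r)⁻¹ := by rw [hh, hMr]; field_simp; norm_num
  have hinv : 0 < (lam * r)⁻¹ := inv_pos.2 hlr0
  have hh0 : 0 < h := by rw [hh']; positivity
  have h2h : 2 * h < (lam * r)⁻¹ := by rw [hh']; nlinarith
  have hhinv : h⁻¹ ≤ 3 * (lam * r) := by
    rw [hh', mul_inv, inv_inv]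
    gcongr
    rw [inv_div, div_le_iff₀ (by positivity)]
    linarith
  set cb := fun k => cube (gridCorner M k) h
  set φ : ℕ → Space → ENNReal := fun n x => ‖iteratedFDeriv ℝ n f x‖ₑ
  have hcell : ∀ k, ∫⁻ x in S ∩ cb k, ENNReal.ofReal (g x) ≤
      ENNReal.ofReal (A * B) * ∑ n ∈ Finset.range 4, ENNReal.ofReal (3 * (h⁻¹) ^ (3 - n)) *
        ∫⁻ x in N ∩ cb k, φ n x := by
    intro k
    rcases (S ∩ cb k).eq_empty_or_nonempty with he | ⟨z, hzS, hzQ⟩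
    · simp [he]
    have hsub : cb k ⊆ N := fun x hx => by
      refine Metric.mem_thickening_iff.2 ⟨z, hzS, ?_⟩
      rw [dist_eq_norm]
      exact (norm_sub_le_of_mem_cube hx hzQ).trans_lt h2h
    rw [Set.inter_eq_right.2 hsub]
    set s := ∑ n ∈ Finset.range 4, ENNReal.ofReal (3 * (h⁻¹) ^ (3 - n)) * ∫⁻ x in cb k, φ n x
    have hsup : ∀ x ∈ cb k, ‖f x‖ₑ ≤ s := fun x hx =>
      enorm_le_sum_lintegral_cube hh0
        (fun y hy => hf.contDiffAt (hNo.mem_nhds (hsub hy))) hx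
    have hpt : ∀ x ∈ S ∩ cb k, ENNReal.ofReal (g x) ≤
        (cb k ∩ S ∩ P).indicator (fun _ => s * ENNReal.ofReal A) x := by
      rintro x ⟨hxS, hxQ⟩
      by_cases hxP : x ∈ P
      · rw [Set.indicator_of_mem (show x ∈ cb k ∩ S ∩ P from ⟨⟨hxQ, hxS⟩, hxP⟩)]
        refine (ENNReal.ofReal_le_ofReal (hg x hxS)).trans ?_
        rw [ENNReal.ofReal_mul (abs_nonneg _), ← Real.norm_eq_abs, ofReal_norm]
        gcongr
        exact hsup x hxQ
      · rw [ENNReal.ofReal_of_nonpos (hg0 x hxS hxP)]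
        exact zero_le
    calc ∫⁻ x in S ∩ cb k, ENNReal.ofReal (g x)
        ≤ ∫⁻ x in S ∩ cb k, (cb k ∩ S ∩ P).indicator (fun _ => s * ENNReal.ofReal A) x :=
          MeasureTheory.setLIntegral_mono' (hS.measurableSet.inter (measurableSet_cube _ _)) hpt
      _ ≤ ∫⁻ x, (cb k ∩ S ∩ P).indicator (fun _ => s * ENNReal.ofReal A) x :=
          MeasureTheory.setLIntegral_le_lintegral _ _
      _ ≤ s * ENNReal.ofReal A * MeasureTheory.volume (cb k ∩ S ∩ P) :=
          MeasureTheory.lintegral_indicator_const_le _ _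
      _ ≤ s * ENNReal.ofReal A * ENNReal.ofReal B := by
          gcongr
          exact hP _ fun x hx y hy => (norm_sub_le_of_mem_cube hx hy).trans h2h.le
      _ = ENNReal.ofReal (A * B) * s := by rw [ENNReal.ofReal_mul hA]; ring
  have hsum : ∀ n ≤ 3, ∑ k, ∫⁻ x in N ∩ cb k, φ n x ≤ ENNReal.ofReal (Cf * (lam * r₁) ^ n) := by
    intro n hn
    rw [← tsum_fintype (L := SummationFilter.unconditional _), ← MeasureTheory.lintegral_iUnion
      (fun k => hNo.measurableSet.inter (measurableSet_cube _ _))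
      (fun k k' hne => (pairwise_disjoint_cube_gridCorner M hne).mono
        Set.inter_subset_right Set.inter_subset_right)]
    refine le_trans ?_ (hfn n hn)
    rw [torusL1Norm]
    simp only [ofReal_norm]
    refine MeasureTheory.lintegral_mono_set (Set.iUnion_subset fun k => ?_)
    exact Set.inter_subset_inter_right _ (cube_gridCorner_subset_torusCell k)
  have hcoef : ∀ n ≤ 3, 3 * (h⁻¹) ^ (3 - n) * (Cf * (lam * r₁) ^ n) ≤ 81 * (lam * r) ^ 3 * Cf := by
    intro n hn
    calc 3 * (h⁻¹) ^ (3 - n) * (Cf * (lam * r₁) ^ n)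
        ≤ 3 * (3 * (lam * r)) ^ (3 - n) * (Cf * (3 * (lam * r)) ^ n) := by
          have h1 : lam * r₁ ≤ 3 * (lam * r) :=
            (mul_le_mul_of_nonneg_left hr₁r hlam.le).trans (by linarith)
          gcongr 3 * ?_ ^ _ * (_ * ?_ ^ _)
      _ = 3 * Cf * ((3 * (lam * r)) ^ (3 - n) * (3 * (lam * r)) ^ n) := by ring
      _ = 3 * Cf * (3 * (lam * r)) ^ 3 := by rw [← pow_add, Nat.sub_add_cancel hn]
      _ = _ := by ring
  calc torusL1Norm S g
      ≤ ∫⁻ x in ⋃ k, S ∩ cb k, ENNReal.ofReal (g x) := by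
        refine MeasureTheory.lintegral_mono_set ?_
        rw [← Set.inter_iUnion]
        exact Set.inter_subset_inter_right _ (torusCell_subset_iUnion_cube hM0)
    _ ≤ ∑ k, ∫⁻ x in S ∩ cb k, ENNReal.ofReal (g x) := by
        rw [← tsum_fintype (L := SummationFilter.unconditional _)]
        exact MeasureTheory.lintegral_iUnion_le _ _
    _ ≤ ∑ k, ENNReal.ofReal (A * B) * ∑ n ∈ Finset.range 4, ENNReal.ofReal (3 * (h⁻¹) ^ (3 - n)) *
        ∫⁻ x in N ∩ cb k, φ n x := Finset.sum_le_sum fun k _ => hcell k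
    _ = ENNReal.ofReal (A * B) * ∑ n ∈ Finset.range 4, ENNReal.ofReal (3 * (h⁻¹) ^ (3 - n)) *
        ∑ k, ∫⁻ x in N ∩ cb k, φ n x := by
        rw [← Finset.mul_sum, Finset.sum_comm]
        simp_rw [Finset.mul_sum]
    _ ≤ ENNReal.ofReal (A * B) *
          ∑ n ∈ Finset.range 4, ENNReal.ofReal (81 * (lam * r) ^ 3 * Cf) := by
        gcongr with n hn
        have hn' : n ≤ 3 := by rw [Finset.mem_range] at hn; omega
        refine (mul_le_mul_right (hsum n hn') _).trans ?_
        rw [← ENNReal.ofReal_mul (by positivity)]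
        exact ENNReal.ofReal_le_ofReal (hcoef n hn')
    _ = ENNReal.ofReal (A * B * (324 * (lam * r) ^ 3 * Cf)) := by
        rw [Finset.sum_const, Finset.card_range, nsmul_eq_mul, ← ENNReal.ofReal_natCast,
          ← ENNReal.ofReal_mul (by positivity), ← ENNReal.ofReal_mul (by positivity)]
        congr 1
        push_cast
        ring

/-! ### The decoupled estimate -/

theorem IsConvexNeighborhood.isOpen {Ω : Set Space} (h : IsConvexNeighborhood Ω) : IsOpen Ω := by
  obtain ⟨C, hC, -, -, rfl⟩ := h
  have : {x : Space | ∃ k : Fin 3 → ℤ, x + latticeVec k ∈ C} =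
      ⋃ k : Fin 3 → ℤ, (fun x => x + latticeVec k) ⁻¹' C := by
    ext x; simp
  rw [this]
  exact isOpen_iUnion fun k => hC.preimage (continuous_id.add continuous_const)

/-- The estimate at a fixed time, for two given transversal families of pipes. -/
theorem exists_torusL1Norm_pipeFlow_mul_le {ξ₁ ξ₂ : Space} (F₁ : RationalFrame ξ₁)
    (F₂ : RationalFrame ξ₂) (P₁ P₂ : PipeProfile) {ε : ℝ} (hε : 0 < ε)
    (hang : |inner ℝ ξ₁ ξ₂| ≤ 1 - ε) (CΦ : ℝ) (m₁ m₂ : ℕ) :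
    ∃ C : ℝ, 0 < C ∧ ∀ {lam r₁ r₂ ell : ℝ} {μ : ℕ}, 0 < μ → lam * r₂ = μ → 0 ≤ r₁ → r₁ ≤ r₂ →
      0 < r₂ → r₂ ≤ 1 → 0 ≤ ell → ell ≤ ε ^ 3 / 8 →
      ∀ {Ω₁ Ω₂ : Set Space}, IsConvexNeighborhood Ω₁ → IsConvexNeighborhood Ω₂ →
      ∀ {Φ₁ X₁ Φ₂ X₂ : Space → Space}, ContDiff ℝ ∞ Φ₁ → ContDiff ℝ ∞ Φ₂ →
      (∀ x, X₁ (Φ₁ x) = x) → (∀ x, Φ₁ (X₁ x) = x) → (∀ x, X₂ (Φ₂ x) = x) → (∀ x, Φ₂ (X₂ x) = x) →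
      (∀ x k, Φ₁ (x + latticeVec k) = Φ₁ x + latticeVec k) →
      (∀ x k, Φ₂ (x + latticeVec k) = Φ₂ x + latticeVec k) →
      (∀ x, Φ₁ x ∈ Ω₁ → ‖fderiv ℝ Φ₁ x - ContinuousLinearMap.id ℝ Space‖ ≤ ell) →
      (∀ x, Φ₂ x ∈ Ω₂ → ‖fderiv ℝ Φ₂ x - ContinuousLinearMap.id ℝ Space‖ ≤ ell) →
      (∀ x, Φ₁ x ∈ Ω₁ → ∀ n, 1 ≤ n → n ≤ m₁ →
        ‖iteratedFDeriv ℝ n Φ₁ x‖ ≤ CΦ * (lam * r₁) ^ (n - 1)) →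
      (∀ x, Φ₂ x ∈ Ω₂ → ∀ n, 1 ≤ n → n ≤ m₂ →
        ‖iteratedFDeriv ℝ n Φ₂ x‖ ≤ CΦ * (lam * r₁) ^ (n - 1)) →
      ∀ {f : Space → ℝ} {Cf : ℝ}, 0 ≤ Cf →
      ContDiffOn ℝ 3 f (Metric.thickening (lam * r₂)⁻¹ (Φ₁ ⁻¹' Ω₁ ∩ Φ₂ ⁻¹' Ω₂)) →
      (∀ n ≤ 3, torusL1Norm (Metric.thickening (lam * r₂)⁻¹ (Φ₁ ⁻¹' Ω₁ ∩ Φ₂ ⁻¹' Ω₂))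
        (fun x => ‖iteratedFDeriv ℝ n f x‖) ≤ ENNReal.ofReal (Cf * (lam * r₁) ^ n)) →
      ∀ s₁ s₂ : Plane, torusL1Norm (Φ₁ ⁻¹' Ω₁ ∩ Φ₂ ⁻¹' Ω₂)
        (fun x => |f x| * ‖iteratedFDeriv ℝ m₁ (fun y => pipeFlow F₁ P₁ lam r₂ s₁ (Φ₁ y)) x‖
          * ‖iteratedFDeriv ℝ m₂ (fun y => pipeFlow F₂ P₂ lam r₂ s₂ (Φ₂ y)) x‖)
        ≤ ENNReal.ofReal (C * (r₂ * Cf * lam ^ (m₁ + m₂))) := by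
  have hε1 : ε ≤ 1 := by linarith [(abs_nonneg _).trans hang]
  obtain ⟨K₁, hK₁, hpipe₁⟩ := exists_iteratedFDeriv_pipeFlow_bound F₁ P₁ CΦ m₁
  obtain ⟨K₂, hK₂, hpipe₂⟩ := exists_iteratedFDeriv_pipeFlow_bound F₂ P₂ CΦ m₂
  obtain ⟨B, hB, hvol⟩ := exists_volume_inter_pipeRegion_bound F₁ F₂ hε hε1 hang
  refine ⟨324 * (K₁ * K₂ * B), by positivity, ?_⟩
  intro lam r₁ r₂ ell μ hμ hlr hr₁ hr₁r hr hr1 hell0 hell Ω₁ Ω₂ hΩ₁ hΩ₂ Φ₁ X₁ Φ₂ X₂ hΦ₁ hΦ₂ hXΦ₁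
    hΦX₁ hXΦ₂ hΦX₂ heq₁ heq₂ hb₁ hb₂ hd₁ hd₂ f Cf hCf hf hfn s₁ s₂
  have hμ1 : (1 : ℝ) ≤ μ := by exact_mod_cast hμ
  have hlr1 : 1 ≤ lam * r₂ := by rw [hlr]; exact hμ1
  have hlam : 0 < lam := by
    by_contra h
    nlinarith
  have hb := fun x (hx : Φ₁ x ∈ Ω₁) =>
    hpipe₁ lam r₁ r₂ hlam hr₁ (hr₁r.trans hr1) hr hr1 s₁ Φ₁ hΦ₁ x (hd₁ x hx)
  have hb' := fun x (hx : Φ₂ x ∈ Ω₂) =>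
    hpipe₂ lam r₁ r₂ hlam hr₁ (hr₁r.trans hr1) hr hr1 s₂ Φ₂ hΦ₂ x (hd₂ x hx)
  have hopen : IsOpen (Φ₁ ⁻¹' Ω₁ ∩ Φ₂ ⁻¹' Ω₂) :=
    (hΩ₁.isOpen.preimage hΦ₁.continuous).inter (hΩ₂.isOpen.preimage hΦ₂.continuous)
  have hmain := torusL1Norm_le_of_concentrated hopen hμ hlr hr hr₁ hr₁r hCf
    (A := K₁ * (lam ^ m₁ * r₂⁻¹) * (K₂ * (lam ^ m₂ * r₂⁻¹))) (by positivity)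
    (B := B * (lam ^ 3)⁻¹) (by positivity)
    (P := (⋃ j, pipeRegion F₁ lam r₂ s₁ Φ₁ j) ∩ ⋃ j, pipeRegion F₂ lam r₂ s₂ Φ₂ j) hf hfn
    (g := fun x => |f x| * ‖iteratedFDeriv ℝ m₁ (fun y => pipeFlow F₁ P₁ lam r₂ s₁ (Φ₁ y)) x‖
          * ‖iteratedFDeriv ℝ m₂ (fun y => pipeFlow F₂ P₂ lam r₂ s₂ (Φ₂ y)) x‖) ?_ ?_ ?_
  · refine hmain.trans (le_of_eq (congrArg _ ?_))
    rw [pow_add]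
    field_simp
  · rintro x ⟨hx₁, hx₂⟩
    have h1 := (hb x hx₁).1
    have h2 := (hb' x hx₂).1
    rw [mul_assoc]
    gcongr
  · rintro x ⟨hx₁, hx₂⟩ hxP
    rw [Set.mem_inter_iff, not_and_or] at hxP
    rcases hxP with hxP | hxP
    · have h0 := (hb x hx₁).2 fun j => by
        by_contra hj
        exact hxP (Set.mem_iUnion.2 ⟨j, not_lt.1 hj⟩)
      simp [h0]
    · have h0 := (hb' x hx₂).2 fun j => by
        by_contra hj
        exact hxP (Set.mem_iUnion.2 ⟨j, not_lt.1 hj⟩)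
      simp [h0]
  · intro Q hQ
    rw [← Set.inter_assoc, ← Set.inter_assoc]
    exact hvol hlam hr hr1 hlr1 hell0 hell hΩ₁ hΩ₂ hΦ₁ hΦ₂ hXΦ₁ hΦX₁ hXΦ₂ hΦX₂ heq₁ heq₂ hb₁ hb₂
      s₁ s₂ Q hQ

theorem proposition5p3
    -- the finite set of directions, with the construction of pipes for each of them
    (K : Finset Space) (F : ∀ ξ : K, RationalFrame (ξ : Space)) (P : K → PipeProfile)
    (ε₀ : ℝ) (hε₀ : 0 < ε₀) (CΦ : ℝ) (m₁ m₂ : ℕ) :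
    ∃ C : ℝ, 0 < C ∧
    ∀ (ξ₁ ξ₂ : K), |inner ℝ (ξ₁ : Space) (ξ₂ : Space)| ≤ 1 - ε₀ →
    ∀ ell : ℝ, 0 < ell → ell ^ (1 / 3 : ℝ) ≤ ε₀ / 2 →
    -- concentration and frequency parameters
    ∀ (lam r₁ r₂ : ℝ) (Ndec : ℕ),
      0 ≤ r₁ → r₁ ≤ r₂ → 0 < r₂ → r₂ ≤ 1 → r₁ / r₂ ≤ 2 / 3 →
      (∃ μ : ℕ, 0 < μ ∧ lam * r₂ = μ) →
      (lam * r₁) ^ (Ndec + 4) ≤ (lam * r₂) ^ Ndec →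
    -- placement of the pipes
    ∀ (s₁ s₂ : Plane),
    -- the velocity field and the two flows
    ∀ (v : ℝ → Space → Space), IsIncompressibleVelocity v →
    ∀ (t₁ t₂ : ℝ) (X₁ X₂ Φ₁ Φ₂ : ℝ → Space → Space),
      IsFlow v t₁ X₁ → IsInverseFlow v t₁ X₁ Φ₁ →
      IsFlow v t₂ X₂ → IsInverseFlow v t₂ X₂ Φ₂ →
    ∀ (Ω₁ Ω₂ : Set Space), IsConvexNeighborhood Ω₁ → IsConvexNeighborhood Ω₂ →
    ∀ τ : ℝ, τ = ell ^ 3 →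
    -- the Lipschitz bound on the velocity
    ∀ Cv : ℝ,
      (∀ t ∈ Set.Icc (t₁ - τ) (t₁ + τ), ∀ x ∈ movingDomain Φ₁ Ω₁ t,
        ‖fderiv ℝ (v t) x‖ ≤ Cv * ell ^ (-(3 / 2) : ℝ)) →
      (∀ t ∈ Set.Icc (t₂ - τ) (t₂ + τ), ∀ x ∈ movingDomain Φ₂ Ω₂ t,
        ‖fderiv ℝ (v t) x‖ ≤ Cv * ell ^ (-(3 / 2) : ℝ)) →
    -- the deformation bounds
      (∀ t ∈ Set.Icc (t₁ - τ) (t₁ + τ), ∀ x ∈ movingDomain Φ₁ Ω₁ t,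
        ‖fderiv ℝ (Φ₁ t) x - ContinuousLinearMap.id ℝ Space‖ ≤ ell ∧
        ∀ n : ℕ, 1 ≤ n → n ≤ max m₁ m₂ →
          ‖iteratedFDeriv ℝ n (Φ₁ t) x‖ ≤ CΦ * (lam * r₁) ^ (n - 1)) →
      (∀ t ∈ Set.Icc (t₂ - τ) (t₂ + τ), ∀ x ∈ movingDomain Φ₂ Ω₂ t,
        ‖fderiv ℝ (Φ₂ t) x - ContinuousLinearMap.id ℝ Space‖ ≤ ell ∧
        ∀ n : ℕ, 1 ≤ n → n ≤ max m₁ m₂ →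
          ‖iteratedFDeriv ℝ n (Φ₂ t) x‖ ≤ CΦ * (lam * r₁) ^ (n - 1)) →
    -- the two moving domains meet
      (∃ t₀ ∈ Set.Icc (t₁ - τ) (t₁ + τ) ∩ Set.Icc (t₂ - τ) (t₂ + τ),
        (movingDomain Φ₁ Ω₁ t₀ ∩ movingDomain Φ₂ Ω₂ t₀).Nonempty) →
    -- the slowly varying function, on a neighbourhood of the intersection of the moving domains
    ∀ (f : ℝ → Space → ℝ) (Cf : ℝ), 0 ≤ Cf →
      (∀ t ∈ Set.Icc (t₁ - τ) (t₁ + τ) ∩ Set.Icc (t₂ - τ) (t₂ + τ),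
        (∀ x (k : Fin 3 → ℤ), f t (x + latticeVec k) = f t x) ∧
        ContDiffOn ℝ ((Ndec + 4 : ℕ) : WithTop ℕ∞) (f t)
          (Metric.thickening (lam * r₂)⁻¹ (movingDomain Φ₁ Ω₁ t ∩ movingDomain Φ₂ Ω₂ t)) ∧
        ∀ n : ℕ, n ≤ Ndec + 4 →
          torusL1Norm
            (Metric.thickening (lam * r₂)⁻¹ (movingDomain Φ₁ Ω₁ t ∩ movingDomain Φ₂ Ω₂ t))
            (fun x => ‖iteratedFDeriv ℝ n (f t) x‖) ≤ ENNReal.ofReal (Cf * (lam * r₁) ^ n)) →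
    -- the conclusion; the norm of a tensor product is the product of the norms
    ∀ t ∈ Set.Icc (t₁ - τ) (t₁ + τ) ∩ Set.Icc (t₂ - τ) (t₂ + τ),
      torusL1Norm (movingDomain Φ₁ Ω₁ t ∩ movingDomain Φ₂ Ω₂ t)
        (fun x => |f t x|
          * ‖iteratedFDeriv ℝ m₁ (fun y => pipeFlow (F ξ₁) (P ξ₁) lam r₂ s₁ (Φ₁ t y)) x‖
          * ‖iteratedFDeriv ℝ m₂ (fun y => pipeFlow (F ξ₂) (P ξ₂) lam r₂ s₂ (Φ₂ t y)) x‖)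
      ≤ ENNReal.ofReal (C * (r₂ * Cf * lam ^ (m₁ + m₂))) := by
  have hpair := fun (p : K × K) (hang : |inner ℝ (p.1 : Space) (p.2 : Space)| ≤ 1 - ε₀) =>
    exists_torusL1Norm_pipeFlow_mul_le (F p.1) (F p.2) (P p.1) (P p.2) hε₀ hang CΦ m₁ m₂
  choose C hC hbound using hpair
  -- the constants of the finitely many admissible pairs are added up
  set D : K × K → ℝ := fun p => by
    classical exact if h : |inner ℝ (p.1 : Space) (p.2 : Space)| ≤ 1 - ε₀ then C p h else 0 with hD
  have hD0 : ∀ p, 0 ≤ D p := fun p => by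
    simp only [hD]
    split_ifs with h
    exacts [(hC p h).le, le_rfl]
  refine ⟨1 + ∑ p, D p, by linarith [Finset.sum_nonneg fun p (_ : p ∈ Finset.univ) => hD0 p], ?_⟩
  intro ξ₁ ξ₂ hang ell hell0 hell lam r₁ r₂ Ndec hr₁ hr₁r hr hr1 _ hμ _ s₁ s₂ v _ t₁ t₂ X₁ X₂ Φ₁ Φ₂
    _ hΦ₁ _ hΦ₂ Ω₁ Ω₂ hΩ₁ hΩ₂ τ _ Cv _ _ hdef₁ hdef₂ _ f Cf hCf hf t ht
  obtain ⟨μ, hμ0, hμ⟩ := hμ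
  have hCD : C (ξ₁, ξ₂) hang ≤ 1 + ∑ p, D p := by
    have h1 := Finset.single_le_sum (fun p _ => hD0 p) (Finset.mem_univ (ξ₁, ξ₂))
    have h2 : D (ξ₁, ξ₂) = C (ξ₁, ξ₂) hang := dif_pos hang
    linarith
  have hell3 : ell ≤ ε₀ ^ 3 / 8 := by
    have h1 : ell = (ell ^ (1 / 3 : ℝ)) ^ 3 := by
      rw [← Real.rpow_natCast, ← Real.rpow_mul hell0.le]
      norm_num
    have h2 : (ell ^ (1 / 3 : ℝ)) ^ 3 ≤ (ε₀ / 2) ^ 3 := by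
      have := Real.rpow_nonneg hell0.le (1 / 3)
      gcongr
    rw [← h1] at h2
    linarith [h2, (by ring : (ε₀ / 2) ^ 3 = ε₀ ^ 3 / 8)]
  have hlam : 0 < lam := by
    have : (0 : ℝ) < μ := by exact_mod_cast hμ0
    by_contra h
    nlinarith
  obtain ⟨-, hfc, hfn⟩ := hf t ht
  have hsm : ∀ {Φ : ℝ → Space → Space}, ContDiff ℝ ∞ (fun p : ℝ × Space => Φ p.1 p.2) →
      ContDiff ℝ ∞ (Φ t) := fun h => h.comp (contDiff_const.prodMk contDiff_id)
  refine (hbound (ξ₁, ξ₂) hang hμ0 hμ hr₁ hr₁r hr hr1 hell0.le hell3 hΩ₁ hΩ₂ (hsm hΦ₁.smooth)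
    (hsm hΦ₂.smooth) (hΦ₁.right_inv t) (hΦ₁.left_inv t) (hΦ₂.right_inv t) (hΦ₂.left_inv t)
    (hΦ₁.equivariant t) (hΦ₂.equivariant t) (fun x hx => (hdef₁ t ht.1 x hx).1)
    (fun x hx => (hdef₂ t ht.2 x hx).1)
    (fun x hx n h1 hn => (hdef₁ t ht.1 x hx).2 n h1 (hn.trans (le_max_left _ _)))
    (fun x hx n h1 hn => (hdef₂ t ht.2 x hx).2 n h1 (hn.trans (le_max_right _ _))) hCf
    (hfc.of_le (by exact_mod_cast (by omega : 3 ≤ Ndec + 4))) (fun n hn => hfn n (by omega))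
    s₁ s₂).trans ?_
  gcongr
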